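/- For an integer $l\ge 3$ let $\epsilon_l$ be a root of the irreducible polynomial $X^3+(l-1)X^2-lX-1\in\mathbb{Z}[X]$, and let $\mathbb{U}_l$ be the unit group of the ring of integers of the cubic field $\mathbb{Q}(\epsilon_l)$. Both $\epsilon_l$ and $\epsilon_l-1$ belong to $\mathbb{U}_l$; let $$j_l=(\mathbb{U}_l:\langle -1,\epsilon_l,\epsilon_l-1\rangle)$$ be the index in $\mathbb{U}_l$ of the subgroup generated by $-1$, $\epsilon_l$ and $\epsilon_l-1$. (i) For every prime $p\ge 3$ there are only finitely many integers $l\ge 3$ for which $p$ divides $j_l$. (ii) For every integer $N\ge 2$ there is an effective bound $l_N$ such that $\gcd(j_l,N!)=1$ for all integers $l\ge 3$ with $l\ge l_N$. Here effective means that $l_N$ can be computed from $N$: the function $N\mapsto l_N$ can be chosen to be computable. -/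

import Mathlib

open Polynomial NumberField

/-- The cubic polynomial `X³ + (l - 1) X² - l X - 1` with integer coefficients. -/
noncomputable def ennolaPoly (l : ℕ) : ℤ[X] :=
  X ^ 3 + C ((l : ℤ) - 1) * X ^ 2 - C (l : ℤ) * X - 1

theorem ennolaPoly_eq (l : ℕ) :
    ennolaPoly l =
      C 1 * X ^ 3 + C ((l : ℤ) - 1) * X ^ 2 + C (-(l : ℤ)) * X + C (-1) := by
  simp only [ennolaPoly, map_neg, map_one]
  ring

theorem ennolaPoly_natDegree (l : ℕ) : (ennolaPoly l).natDegree = 3 := by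
  rw [ennolaPoly_eq]
  exact natDegree_cubic one_ne_zero

theorem ennolaPoly_monic (l : ℕ) : (ennolaPoly l).Monic := by
  rw [Monic, ennolaPoly_eq]
  exact leadingCoeff_cubic one_ne_zero

theorem ennolaPoly_irreducible (l : ℕ) : Irreducible (ennolaPoly l) := by
  have hm := ennolaPoly_monic l
  rw [hm.irreducible_iff_roots_eq_zero_of_degree_le_three
    (by rw [ennolaPoly_natDegree]; norm_num) (by rw [ennolaPoly_natDegree])]
  refine Multiset.eq_zero_of_forall_notMem fun x hx => ?_
  rw [mem_roots hm.ne_zero, IsRoot.def] at hx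
  have h : x * ((x - 1) * (x + l)) = 1 := by
    simp only [ennolaPoly, eval_sub, eval_add, eval_mul, eval_pow, eval_X, eval_C, eval_one] at hx
    linear_combination hx
  rcases Int.isUnit_iff.1 (IsUnit.of_mul_eq_one _ h) with rfl | rfl
  · norm_num at h
  · omega

instance ennolaPoly_map_irreducible (l : ℕ) :
    Fact (Irreducible ((ennolaPoly l).map (Int.castRingHom ℚ))) :=
  ⟨((ennolaPoly_monic l).irreducible_iff_irreducible_map_fraction_map (K := ℚ)).1
    (ennolaPoly_irreducible l)⟩

/-- The cubic field `ℚ(ε_l) = ℚ[X] / (X³ + (l - 1) X² - l X - 1)`. -/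
abbrev EnnolaField (l : ℕ) : Type :=
  AdjoinRoot ((ennolaPoly l).map (Int.castRingHom ℚ))

/-- The root `ε_l` in the field `ℚ(ε_l)`. -/
noncomputable def ennolaRoot (l : ℕ) : EnnolaField l :=
  AdjoinRoot.root ((ennolaPoly l).map (Int.castRingHom ℚ))

theorem ennolaRoot_aeval (l : ℕ) : aeval (ennolaRoot l) (ennolaPoly l) = 0 := by
  rw [← aeval_map_algebraMap ℚ]
  exact AdjoinRoot.eval₂_root ((ennolaPoly l).map (Int.castRingHom ℚ))

/-- The root `ε_l` as an element of the ring of integers of `ℚ(ε_l)`. -/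
noncomputable def ennolaInt (l : ℕ) : 𝓞 (EnnolaField l) :=
  ⟨ennolaRoot l, ennolaPoly l, ennolaPoly_monic l, ennolaRoot_aeval l⟩

theorem ennolaInt_mul (l : ℕ) :
    ennolaInt l * ((ennolaInt l - 1) * (ennolaInt l + (l : 𝓞 (EnnolaField l)))) = 1 := by
  apply RingOfIntegers.coe_injective
  have h := ennolaRoot_aeval l
  simp only [ennolaPoly, map_sub, map_add, map_mul, map_pow, aeval_X, map_one,
    map_natCast] at h
  have e : algebraMap (𝓞 (EnnolaField l)) (EnnolaField l) (ennolaInt l) = ennolaRoot l := rfl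
  simp only [map_sub, map_add, map_mul, map_one, map_natCast, e]
  linear_combination h

/-- The unit `ε_l` of the ring of integers of `ℚ(ε_l)`. -/
noncomputable def ennolaUnit (l : ℕ) : (𝓞 (EnnolaField l))ˣ :=
  Units.mkOfMulEqOne (ennolaInt l) ((ennolaInt l - 1) * (ennolaInt l + l)) (ennolaInt_mul l)

/-- The unit `ε_l - 1` of the ring of integers of `ℚ(ε_l)`. -/
noncomputable def ennolaUnitSubOne (l : ℕ) : (𝓞 (EnnolaField l))ˣ :=
  Units.mkOfMulEqOne (ennolaInt l - 1) (ennolaInt l * (ennolaInt l + l))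
    (by linear_combination ennolaInt_mul l)

/-- The unit index `j_l = (U_l : ⟨-1, ε_l, ε_l - 1⟩)`, where `U_l` is the unit group of the ring
of integers of `ℚ(ε_l)`. -/
noncomputable def unitIndex (l : ℕ) : ℕ :=
  (Subgroup.closure {-1, ennolaUnit l, ennolaUnitSubOne l} :
    Subgroup (𝓞 (EnnolaField l))ˣ).index

/-! Suppose that a prime `p` divides `j_l` and that `τ = l ^ (1 / p)` is large compared to `p`. By
Cauchy's theorem some unit `u` satisfies `u ^ p = ± ε_l ^ a * (ε_l - 1) ^ b` with `a`, `b` not both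
divisible by `p`. As the conjugates of `ε_l` are close to `0`, `1` and `-l`, those of `u` have
absolute values `τ ^ n + (c / p) τ ^ (n - p) + O(τ ^ (n - 2p))` with three integers `n` of sum
zero, not all divisible by `p`. Multiplying the exponents by a constant modulo `p` and reducing
them modulo `p` amounts to replacing `u` by another unit, so they can be made to suit the argument:
if two of them agree modulo `p` they become `1, 1, -2`, if one of them vanishes modulo `p` they
become `p, -1, 1 - p`, and otherwise exactly one of them is positive and all are less than `p` in
absolute value. In each case some polynomial expression with integer coefficients in `l` and the
traces of such units and of their squares has all its nonnegative powers of `τ` cancelled, and its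
terms have distinct negative exponents: it is a nonzero integer of absolute value less than `1`.
For three distinct residues one needs two units with the same positive exponent. If the negative
exponents of the two units coincide, which happens when the residues are in geometric progression
modulo `p`, their coefficients `c` still differ. -/

section RealEmbeddings

variable {K ι : Type*} [Field K] [NumberField K] [Fintype ι] {φ : ι → K →ₐ[ℚ] ℝ}

theorem bijective_ofReal_comp_embedding (hφ : Function.Injective φ)
    (hι : Fintype.card ι = Module.finrank ℚ K) :
    Function.Bijective fun i ↦ (Complex.ofRealAm.restrictScalars ℚ).comp (φ i) := by
  rw [Fintype.bijective_iff_injective_and_card]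
  refine ⟨fun i j hij ↦ hφ (AlgHom.ext fun x ↦ ?_), by rw [AlgHom.card, hι]⟩
  exact Complex.ofReal_injective (DFunLike.congr_fun hij x)

theorem trace_eq_sum_real_embeddings (hφ : Function.Injective φ)
    (hι : Fintype.card ι = Module.finrank ℚ K) (x : K) :
    (Algebra.trace ℚ K x : ℝ) = ∑ i, φ i x := by
  have h := trace_eq_sum_embeddings (K := ℚ) (L := K) ℂ (x := x)
  rw [← (bijective_ofReal_comp_embedding hφ hι).sum_comp fun σ ↦ σ x] at h
  apply Complex.ofReal_injective
  push_cast
  exact h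

theorem exists_int_eq_sum_real_embeddings (hφ : Function.Injective φ)
    (hι : Fintype.card ι = Module.finrank ℚ K) (x : 𝓞 K) :
    ∃ t : ℤ, (t : ℝ) = ∑ i, φ i x := by
  refine ⟨Algebra.intTrace ℤ (𝓞 K) x, ?_⟩
  rw [← trace_eq_sum_real_embeddings hφ hι,
    ← Algebra.algebraMap_intTrace (A := ℤ) (K := ℚ) (L := K) x]
  simp

theorem isTotallyReal_of_real_embeddings (hφ : Function.Injective φ)
    (hι : Fintype.card ι = Module.finrank ℚ K) : IsTotallyReal K := by
  refine ⟨fun w ↦ ?_⟩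
  obtain ⟨i, hi⟩ := (bijective_ofReal_comp_embedding hφ hι).2 (RingHom.toRatAlgHom w.embedding)
  rw [InfinitePlace.isReal_iff, ComplexEmbedding.isReal_iff]
  refine RingHom.ext fun x ↦ ?_
  have hx : w.embedding x = (φ i x : ℂ) := (DFunLike.congr_fun hi x).symm
  rw [ComplexEmbedding.conjugate_coe_eq, hx, Complex.conj_ofReal]

theorem units_rank_of_isTotallyReal [IsTotallyReal K] :
    Units.rank K = Module.finrank ℚ K - 1 := by
  rw [Units.rank, InfinitePlace.card_eq_nrRealPlaces_add_nrComplexPlaces,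
    IsTotallyReal.nrComplexPlaces_eq_zero, add_zero, ← IsTotallyReal.finrank]

end RealEmbeddings

section Units

theorem exists_place_eq_abs {K : Type*} [Field K] (φ : K →+* ℝ) :
    ∃ w : InfinitePlace K, ∀ x, w x = |φ x| := by
  refine ⟨InfinitePlace.mk (Complex.ofRealHom.comp φ), fun x ↦ ?_⟩
  rw [InfinitePlace.apply, RingHom.comp_apply, Complex.ofRealHom_eq_coe, Complex.norm_real,
    Real.norm_eq_abs]

variable {K ι : Type*} [Field K] [NumberField K] [Fintype ι]

theorem sum_mul_log_place_eq_zero {u : ι → (𝓞 K)ˣ} {c : ι → ℝ}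
    (h : ∑ i, c i • Units.logEmbedding K (Additive.ofMul (u i)) = 0) (w : InfinitePlace K) :
    ∑ i, c i * Real.log (w (u i : K)) = 0 := by
  classical
  set g : InfinitePlace K → ℝ := fun w ↦ w.mult * ∑ i, c i * Real.log (w (u i : K)) with hg
  have hne : ∀ w ≠ Units.dirichletUnitTheorem.w₀, g w = 0 := fun w hw ↦ by
    have hw' := congrFun h ⟨w, hw⟩
    simp only [Finset.sum_apply, Pi.smul_apply, smul_eq_mul, Pi.zero_apply,
      Units.dirichletUnitTheorem.logEmbedding_component] at hw'
    rw [hg, ← hw']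
    simp only [Finset.mul_sum, mul_left_comm]
  have hsum : ∑ w, g w = 0 := by
    simp only [hg, Finset.mul_sum, mul_left_comm _ (c _)]
    rw [Finset.sum_comm]
    simp only [← Finset.mul_sum, Units.sum_mult_mul_log, mul_zero, Finset.sum_const_zero]
  have hw₀ : g Units.dirichletUnitTheorem.w₀ = 0 := by
    rwa [Fintype.sum_eq_single _ hne] at hsum
  have hw : g w = 0 := (eq_or_ne w Units.dirichletUnitTheorem.w₀).elim (· ▸ hw₀) (hne w)
  exact (mul_eq_zero.1 hw).resolve_left (Nat.cast_ne_zero.2 InfinitePlace.mult_ne_zero)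

theorem closure_range_finiteIndex {u : ι → (𝓞 K)ˣ} (hι : Fintype.card ι = Units.rank K)
    (hu : ∀ c : ι → ℝ, (∀ w : InfinitePlace K, ∑ i, c i * Real.log (w (u i : K)) = 0) → c = 0) :
    (Subgroup.closure (Set.range u)).FiniteIndex := by
  let e : Fin (Units.rank K) ≃ ι := (Fintype.equivFinOfCardEq hι).symm
  have hind : LinearIndependent ℝ fun i ↦ Units.logEmbedding K (Additive.ofMul (u i)) :=
    Fintype.linearIndependent_iff.2 fun c hc ↦
      congrFun (hu c (sum_mul_log_place_eq_zero hc))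
  have hmax : Units.IsMaxRank (u ∘ e) := hind.comp e e.injective
  rw [Units.isMaxRank_iff_closure_finiteIndex, EquivLike.range_comp] at hmax
  exact hmax

end Units

theorem exists_notMem_pow_mem_of_prime_dvd_index {G : Type*} [CommGroup G] {H : Subgroup G}
    [H.FiniteIndex] {p : ℕ} (hp : p.Prime) (h : p ∣ H.index) : ∃ g ∉ H, g ^ p ∈ H := by
  have : Fact p.Prime := ⟨hp⟩
  obtain ⟨x, hx⟩ := exists_prime_orderOf_dvd_card' (G := G ⧸ H) p h
  obtain ⟨g, rfl⟩ := QuotientGroup.mk_surjective x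
  refine ⟨g, fun hg ↦ hp.one_lt.ne' ?_, ?_⟩
  · rw [← hx, (QuotientGroup.eq_one_iff g).2 hg, orderOf_one]
  · rw [← QuotientGroup.eq_one_iff, QuotientGroup.mk_pow, ← hx, pow_orderOf_eq_one]

section EnnolaField

variable {F : Type*} [Field F] [Algebra ℚ F] {l : ℕ}

theorem map_ennolaRoot_mul (φ : EnnolaField l →ₐ[ℚ] F) :
    φ (ennolaRoot l) * ((φ (ennolaRoot l) - 1) * (φ (ennolaRoot l) + l)) = 1 := by
  have h := congrArg (fun x : 𝓞 (EnnolaField l) ↦ φ x) (ennolaInt_mul l)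
  simp only [map_mul, map_sub, map_add, map_one, map_natCast] at h
  exact h

theorem exists_algHom_ennolaRoot_eq {x : F} (hx : x * ((x - 1) * (x + l)) = 1) :
    ∃ φ : EnnolaField l →ₐ[ℚ] F, φ (ennolaRoot l) = x := by
  refine ⟨AdjoinRoot.liftAlgHom _ (Algebra.ofId ℚ F) x ?_, AdjoinRoot.liftAlgHom_root _ _ _ _⟩
  rw [eval₂_map]
  simp only [ennolaPoly, eval₂_sub, eval₂_add, eval₂_mul, eval₂_pow, eval₂_X,
    eval₂_natCast, eval₂_one, map_sub, map_natCast, map_one]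
  linear_combination hx

theorem finrank_ennolaField (l : ℕ) : Module.finrank ℚ (EnnolaField l) = 3 := by
  have hm : ((ennolaPoly l).map (Int.castRingHom ℚ)).Monic := (ennolaPoly_monic l).map _
  rw [(AdjoinRoot.powerBasis hm.ne_zero).finrank, AdjoinRoot.powerBasis_dim,
    (ennolaPoly_monic l).natDegree_map, ennolaPoly_natDegree]

theorem coe_ennolaUnit (l : ℕ) : (ennolaUnit l : EnnolaField l) = ennolaRoot l := rfl

theorem coe_ennolaUnitSubOne (l : ℕ) :
    (ennolaUnitSubOne l : EnnolaField l) = ennolaRoot l - 1 := rfl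

end EnnolaField

section RealRoots

variable {l : ℕ}

theorem exists_algHom_ennolaRoot_mem_Ioo {a b : ℝ} (hab : a ≤ b)
    (h : (a * ((a - 1) * (a + l)) - 1) * (b * ((b - 1) * (b + l)) - 1) < 0) :
    ∃ φ : EnnolaField l →ₐ[ℚ] ℝ, φ (ennolaRoot l) ∈ Set.Ioo a b := by
  have hc : ContinuousOn (fun x : ℝ ↦ x * ((x - 1) * (x + l))) (Set.Icc a b) := by fun_prop
  obtain ⟨x, hx, hx1⟩ : ∃ x ∈ Set.Ioo a b, x * ((x - 1) * (x + l)) = 1 := by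
    rcases mul_neg_iff.1 h with ⟨ha, hb⟩ | ⟨ha, hb⟩
    · exact intermediate_value_Ioo' hab hc ⟨sub_neg.1 hb, sub_pos.1 ha⟩
    · exact intermediate_value_Ioo hab hc ⟨sub_neg.1 ha, sub_pos.1 hb⟩
  obtain ⟨φ, rfl⟩ := exists_algHom_ennolaRoot_eq hx1
  exact ⟨φ, hx⟩

theorem exists_ennolaRoot_near_zero (hl : 3 ≤ l) :
    ∃ φ : EnnolaField l →ₐ[ℚ] ℝ,
      φ (ennolaRoot l) ∈ Set.Ioo (-(1 / (l : ℝ))) (-(1 / ((l : ℝ) + 1))) := by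
  have hl' : (3 : ℝ) ≤ l := by exact_mod_cast hl
  refine exists_algHom_ennolaRoot_mem_Ioo (by gcongr; linarith) (mul_neg_of_pos_of_neg ?_ ?_)
  · calc (0 : ℝ) < ((l : ℝ) ^ 2 - l - 1) / l ^ 3 := div_pos (by nlinarith) (by positivity)
      _ = _ := by field_simp; ring
  · calc _ = -((2 * (l : ℝ) + 3) / (l + 1) ^ 3) := by field_simp; ring
      _ < 0 := neg_lt_zero.2 (by positivity)

theorem exists_ennolaRoot_near_one (hl : 0 < l) :
    ∃ φ : EnnolaField l →ₐ[ℚ] ℝ,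
      φ (ennolaRoot l) ∈ Set.Ioo (1 + 1 / ((l : ℝ) + 3)) (1 + 1 / (l : ℝ)) := by
  have : (0 : ℝ) < l := by exact_mod_cast hl
  refine exists_algHom_ennolaRoot_mem_Ioo (by gcongr; linarith) (mul_neg_of_neg_of_pos ?_ ?_)
  · calc _ = -(((l : ℝ) ^ 2 + 7 * l + 11) / (l + 3) ^ 3) := by field_simp; ring
      _ < 0 := neg_lt_zero.2 (by positivity)
  · calc (0 : ℝ) < (2 * (l : ℝ) ^ 2 + 2 * l + 1) / l ^ 3 := by positivity
      _ = _ := by field_simp; ring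

theorem exists_ennolaRoot_near_neg (hl : 3 ≤ l) :
    ∃ φ : EnnolaField l →ₐ[ℚ] ℝ,
      φ (ennolaRoot l) ∈ Set.Ioo (-(l : ℝ)) (-(l : ℝ) + 1 / (l : ℝ) ^ 2) := by
  have hl' : (3 : ℝ) ≤ l := by exact_mod_cast hl
  refine exists_algHom_ennolaRoot_mem_Ioo (le_add_of_nonneg_right (by positivity))
    (mul_neg_of_neg_of_pos (by simp) ?_)
  calc (0 : ℝ) < ((l : ℝ) ^ 2 * (l * (l ^ 2 - 2) - 1) + 1) / l ^ 6 := by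
        have : (1 : ℝ) ≤ l * (l ^ 2 - 2) := by nlinarith
        have := mul_nonneg (sq_nonneg (l : ℝ)) (sub_nonneg.2 this)
        positivity
    _ = _ := by field_simp; ring

/-- The real embeddings of `ℚ(ε_l)`, numbered so that the conjugates of `ε_l` are close to `0`, `1`
and `-l` in this order. -/
structure LocatesRoots (φ : Fin 3 → EnnolaField l →ₐ[ℚ] ℝ) : Prop where
  near_zero : φ 0 (ennolaRoot l) ∈ Set.Ioo (-(1 / (l : ℝ))) (-(1 / ((l : ℝ) + 1)))
  near_one : φ 1 (ennolaRoot l) ∈ Set.Ioo (1 + 1 / ((l : ℝ) + 3)) (1 + 1 / (l : ℝ))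
  near_neg : φ 2 (ennolaRoot l) ∈ Set.Ioo (-(l : ℝ)) (-(l : ℝ) + 1 / (l : ℝ) ^ 2)

theorem exists_locatesRoots (hl : 3 ≤ l) :
    ∃ φ : Fin 3 → EnnolaField l →ₐ[ℚ] ℝ, LocatesRoots φ := by
  obtain ⟨φ₀, h₀⟩ := exists_ennolaRoot_near_zero hl
  obtain ⟨φ₁, h₁⟩ := exists_ennolaRoot_near_one (by lia : 0 < l)
  obtain ⟨φ₂, h₂⟩ := exists_ennolaRoot_near_neg hl
  exact ⟨![φ₀, φ₁, φ₂], h₀, h₁, h₂⟩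

namespace LocatesRoots

variable {φ : Fin 3 → EnnolaField l →ₐ[ℚ] ℝ}

theorem root_zero_neg (h : LocatesRoots φ) : φ 0 (ennolaRoot l) < 0 :=
  h.near_zero.2.trans (neg_lt_zero.2 (by positivity))

theorem neg_one_lt_root_zero (h : LocatesRoots φ) (hl : 3 ≤ l) : -1 < φ 0 (ennolaRoot l) := by
  have hl' : (3 : ℝ) ≤ l := by exact_mod_cast hl
  have : 1 / (l : ℝ) < 1 := by rw [div_lt_one] <;> linarith
  linarith [h.near_zero.1]

theorem one_lt_root_one (h : LocatesRoots φ) : 1 < φ 1 (ennolaRoot l) :=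
  lt_trans (lt_add_of_pos_right 1 (by positivity)) h.near_one.1

theorem root_two_lt_neg_one (h : LocatesRoots φ) (hl : 3 ≤ l) : φ 2 (ennolaRoot l) < -1 := by
  have hl' : (3 : ℝ) ≤ l := by exact_mod_cast hl
  have : 1 / (l : ℝ) ^ 2 < 1 := by rw [div_lt_one] <;> nlinarith
  linarith [h.near_neg.2]

theorem injective (h : LocatesRoots φ) (hl : 3 ≤ l) : Function.Injective φ := by
  have h₀ := h.root_zero_neg
  have h₀' := h.neg_one_lt_root_zero hl
  have h₁ := h.one_lt_root_one
  have h₂ := h.root_two_lt_neg_one hl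
  intro i j hij
  have hroot := congrArg (· (ennolaRoot l)) hij
  fin_cases i <;> fin_cases j <;> first | rfl | (dsimp at hroot; linarith)

end LocatesRoots

end RealRoots

section Subgroup

variable {l p : ℕ} {φ : Fin 3 → EnnolaField l →ₐ[ℚ] ℝ}

/-- The group generated by `-1`, `ε_l` and `ε_l - 1`, whose index is `unitIndex l`. -/
noncomputable abbrev ennolaSubgroup (l : ℕ) : Subgroup (𝓞 (EnnolaField l))ˣ :=
  Subgroup.closure {-1, ennolaUnit l, ennolaUnitSubOne l}

theorem zpow_mul_zpow_mem_ennolaSubgroup (l : ℕ) (a b : ℤ) :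
    ennolaUnit l ^ a * ennolaUnitSubOne l ^ b ∈ ennolaSubgroup l :=
  mul_mem (zpow_mem (Subgroup.subset_closure (by simp)) a)
    (zpow_mem (Subgroup.subset_closure (by simp)) b)

theorem exists_sq_eq_of_mem_ennolaSubgroup {x : (𝓞 (EnnolaField l))ˣ}
    (hx : x ∈ ennolaSubgroup l) :
    ∃ a b : ℤ, x ^ 2 = (ennolaUnit l ^ a * ennolaUnitSubOne l ^ b) ^ 2 := by
  induction hx using Subgroup.closure_induction with
  | mem x hx =>
    rcases hx with rfl | rfl | rfl
    · exact ⟨0, 0, by simp⟩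
    · exact ⟨1, 0, by simp⟩
    · exact ⟨0, 1, by simp⟩
  | one => exact ⟨0, 0, by simp⟩
  | mul x y _ _ hx hy =>
    obtain ⟨a, b, hx⟩ := hx
    obtain ⟨c, d, hy⟩ := hy
    exact ⟨a + c, b + d, by rw [mul_pow, hx, hy, ← mul_pow, mul_mul_mul_comm, zpow_add, zpow_add]⟩
  | inv x _ hx =>
    obtain ⟨a, b, hx⟩ := hx
    exact ⟨-a, -b, by rw [inv_pow, hx, ← inv_pow, mul_inv, zpow_neg, zpow_neg]⟩

theorem mem_ennolaSubgroup_of_isOfFinOrder {ζ : (𝓞 (EnnolaField l))ˣ} (hζ : IsOfFinOrder ζ) :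
    ζ ∈ ennolaSubgroup l := by
  have hodd : Odd (Module.finrank ℚ (EnnolaField l)) := by rw [finrank_ennolaField]; decide
  have hmem : ζ ∈ Units.torsion (EnnolaField l) := (CommGroup.mem_torsion _).2 hζ
  rcases Units.torsion_eq_one_or_neg_one_of_odd_finrank hodd ⟨ζ, hmem⟩ with h | h
  · exact (show ζ = 1 from h) ▸ one_mem _
  · exact (show ζ = -1 from h) ▸ Subgroup.subset_closure (by simp)

theorem mem_ennolaSubgroup_of_sq_pow_eq {u v : (𝓞 (EnnolaField l))ˣ} (hp : 0 < p)
    (hv : v ∈ ennolaSubgroup l) (huv : (u ^ p) ^ 2 = (v ^ p) ^ 2) : u ∈ ennolaSubgroup l := by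
  have hfin : IsOfFinOrder (u * v⁻¹) :=
    isOfFinOrder_iff_pow_eq_one.2 ⟨p * 2, by lia, by
      rw [mul_pow, inv_pow, pow_mul, huv, ← pow_mul, mul_inv_cancel]⟩
  simpa using mul_mem (mem_ennolaSubgroup_of_isOfFinOrder hfin) hv

namespace LocatesRoots

theorem units_rank_eq_two (h : LocatesRoots φ) (hl : 3 ≤ l) : Units.rank (EnnolaField l) = 2 := by
  have := isTotallyReal_of_real_embeddings (h.injective hl) (by simp [finrank_ennolaField])
  rw [units_rank_of_isTotallyReal, finrank_ennolaField]

theorem eq_zero_of_mul_log_add_mul_log_eq_zero (h : LocatesRoots φ) (hl : 3 ≤ l) {s t : ℝ}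
    (hst : ∀ i, s * Real.log |φ i (ennolaRoot l)| + t * Real.log |φ i (ennolaRoot l) - 1| = 0) :
    s = 0 ∧ t = 0 := by
  have h₀ := h.root_zero_neg
  have h₀' := h.neg_one_lt_root_zero hl
  have h₂ := h.root_two_lt_neg_one hl
  have hlog₀ : Real.log |φ 0 (ennolaRoot l)| < 0 :=
    Real.log_neg (abs_pos.2 h₀.ne) (abs_lt.2 ⟨h₀', by linarith⟩)
  have hlog₀' : 0 < Real.log |φ 0 (ennolaRoot l) - 1| :=
    Real.log_pos (lt_abs.2 (.inr (by linarith)))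
  have hlog₂ : 0 < Real.log |φ 2 (ennolaRoot l)| := Real.log_pos (lt_abs.2 (.inr (by linarith)))
  have hlog₂' : 0 < Real.log |φ 2 (ennolaRoot l) - 1| :=
    Real.log_pos (lt_abs.2 (.inr (by linarith)))
  have hdet : Real.log |φ 0 (ennolaRoot l)| * Real.log |φ 2 (ennolaRoot l) - 1| -
      Real.log |φ 2 (ennolaRoot l)| * Real.log |φ 0 (ennolaRoot l) - 1| < 0 :=
    sub_neg.2 ((mul_neg_of_neg_of_pos hlog₀ hlog₂').trans (mul_pos hlog₂ hlog₀'))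
  have hs : s = 0 := by
    refine (mul_eq_zero.1 ?_).resolve_right hdet.ne
    linear_combination Real.log |φ 2 (ennolaRoot l) - 1| * hst 0 -
      Real.log |φ 0 (ennolaRoot l) - 1| * hst 2
  refine ⟨hs, (mul_eq_zero.1 ?_).resolve_right hlog₂'.ne'⟩
  linear_combination hst 2 - Real.log |φ 2 (ennolaRoot l)| * hs

theorem finiteIndex_ennolaSubgroup (h : LocatesRoots φ) (hl : 3 ≤ l) :
    (ennolaSubgroup l).FiniteIndex := by
  have hfin := closure_range_finiteIndex (u := ![ennolaUnit l, ennolaUnitSubOne l])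
    (by rw [h.units_rank_eq_two hl, Fintype.card_fin]) fun c hc ↦ by
      have hc' : c 0 = 0 ∧ c 1 = 0 := by
        refine h.eq_zero_of_mul_log_add_mul_log_eq_zero hl fun i ↦ ?_
        obtain ⟨w, hw⟩ := exists_place_eq_abs (φ i : EnnolaField l →+* ℝ)
        have hcw := hc w
        simp only [Fin.sum_univ_two, Matrix.cons_val_zero, Matrix.cons_val_one, hw,
          coe_ennolaUnit, coe_ennolaUnitSubOne, RingHom.coe_coe, map_sub, map_one] at hcw
        exact hcw
      ext i
      fin_cases i
      exacts [hc'.1, hc'.2]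
  have hsub : Set.range ![ennolaUnit l, ennolaUnitSubOne l] ⊆
      {-1, ennolaUnit l, ennolaUnitSubOne l} := by simp [Set.insert_subset_iff]
  exact Subgroup.finiteIndex_of_le (Subgroup.closure_mono hsub)

end LocatesRoots

end Subgroup

section Exponents

variable {l p : ℕ} {u : (𝓞 (EnnolaField l))ˣ} {n m : Fin 3 → ℤ}

/-- The unit `u` is, up to sign, a `p`-th root of the element of `⟨ε_l, ε_l - 1⟩` whose conjugates
grow like the powers of `l` with exponents `n 0`, `n 1`, `n 2`. Squaring removes the sign. -/
def HasExponents (p : ℕ) (u : (𝓞 (EnnolaField l))ˣ) (n : Fin 3 → ℤ) : Prop :=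
  ∑ i, n i = 0 ∧ (u ^ p) ^ 2 = (ennolaUnit l ^ (-n 0) * ennolaUnitSubOne l ^ (-n 1)) ^ 2

theorem exists_hasExponents [(ennolaSubgroup l).FiniteIndex] (hp : p.Prime)
    (hdvd : p ∣ unitIndex l) :
    ∃ (u : (𝓞 (EnnolaField l))ˣ) (n : Fin 3 → ℤ),
      HasExponents p u n ∧ ∃ i, (n i : ZMod p) ≠ 0 := by
  obtain ⟨u, hu, hup⟩ := exists_notMem_pow_mem_of_prime_dvd_index hp hdvd
  obtain ⟨a, b, hab⟩ := exists_sq_eq_of_mem_ennolaSubgroup hup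
  refine ⟨u, ![-a, -b, a + b], ⟨by simp [Fin.sum_univ_three]; ring, by simpa using hab⟩, ?_⟩
  by_contra! hn
  obtain ⟨a, rfl⟩ : (p : ℤ) ∣ a := by
    simpa using (ZMod.intCast_zmod_eq_zero_iff_dvd _ p).1 (hn 0)
  obtain ⟨b, rfl⟩ : (p : ℤ) ∣ b := by
    simpa using (ZMod.intCast_zmod_eq_zero_iff_dvd _ p).1 (hn 1)
  refine hu (mem_ennolaSubgroup_of_sq_pow_eq hp.pos (zpow_mul_zpow_mem_ennolaSubgroup l a b) ?_)
  rw [hab, mul_pow _ _ p, mul_comm (p : ℤ), mul_comm (p : ℤ), zpow_mul, zpow_mul, zpow_natCast,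
    zpow_natCast]

theorem HasExponents.exists_of_eq_mul (hu : HasExponents p u n) (hm : ∑ i, m i = 0)
    {κ : ZMod p} (hmn : ∀ i, (m i : ZMod p) = κ * n i) :
    ∃ v : (𝓞 (EnnolaField l))ˣ, HasExponents p v m := by
  obtain ⟨k, rfl⟩ := ZMod.intCast_surjective κ
  have hdvd (i) : ∃ d, m i = k * n i + p * d := by
    obtain ⟨d, hd⟩ := (ZMod.intCast_eq_intCast_iff_dvd_sub (k * n i) (m i) p).1
      (by push_cast; exact (hmn i).symm)
    exact ⟨d, by linear_combination hd⟩
  choose d hd using hdvd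
  refine ⟨u ^ k * (ennolaUnit l ^ (-d 0) * ennolaUnitSubOne l ^ (-d 1)), hm, ?_⟩
  calc ((u ^ k * (ennolaUnit l ^ (-d 0) * ennolaUnitSubOne l ^ (-d 1))) ^ p) ^ 2
      = ((u ^ p) ^ 2) ^ k *
          ((ennolaUnit l ^ (-d 0) * ennolaUnitSubOne l ^ (-d 1)) ^ p) ^ 2 := by
        rw [mul_pow, mul_pow]
        congr 1
        simp only [← zpow_natCast, ← zpow_mul]
        congr 1
        ring
    _ = ((ennolaUnit l ^ (-n 0) * ennolaUnitSubOne l ^ (-n 1)) ^ 2) ^ k *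
          ((ennolaUnit l ^ (-d 0) * ennolaUnitSubOne l ^ (-d 1)) ^ p) ^ 2 := by rw [hu.2]
    _ = (ennolaUnit l ^ (-m 0) * ennolaUnitSubOne l ^ (-m 1)) ^ 2 := by
        simp only [← zpow_natCast, ← zpow_mul, mul_zpow]
        rw [mul_mul_mul_comm, ← zpow_add, ← zpow_add, hd 0, hd 1]
        congr 2 <;> ring

end Exponents

section LogExpansion

/-- `|y| = l ^ e * exp (c / l + O(1 / l²))`, with the constant `C` in the error term. Note that
`Real.log y` is `log |y|`. -/
def HasLogExpansion (l : ℝ) (e c : ℤ) (C y : ℝ) : Prop :=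
  |Real.log y - (e * Real.log l + c / l)| ≤ C / l ^ 2

namespace HasLogExpansion

variable {l C C' y z : ℝ} {e e' c c' : ℤ}

theorem mul (hy : HasLogExpansion l e c C y) (hz : HasLogExpansion l e' c' C' z) (hy₀ : y ≠ 0)
    (hz₀ : z ≠ 0) : HasLogExpansion l (e + e') (c + c') (C + C') (y * z) := by
  rw [HasLogExpansion, Real.log_mul hy₀ hz₀, add_div]
  push_cast
  refine le_trans (le_of_eq ?_) ((abs_add_le _ _).trans (add_le_add hy hz))
  congr 1
  ring

theorem zpow (hy : HasLogExpansion l e c C y) (k : ℤ) :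
    HasLogExpansion l (k * e) (k * c) (|k| * C) (y ^ k) := by
  rw [HasLogExpansion, Real.log_zpow, mul_div_assoc]
  refine le_trans (le_of_eq ?_) (mul_le_mul_of_nonneg_left hy (by positivity))
  rw [Int.cast_abs, ← abs_mul]
  push_cast
  congr 1
  ring

theorem mono (hy : HasLogExpansion l e c C y) (hC : C ≤ C') : HasLogExpansion l e c C' y :=
  le_trans hy (by gcongr)

theorem of_mul_eq_one (hy : HasLogExpansion l e c C y) (hyz : y * z = 1) :
    HasLogExpansion l (-e) (-c) C z := by
  simpa [eq_inv_of_mul_eq_one_right hyz] using hy.zpow (-1)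

theorem neg_iff : HasLogExpansion l e c C (-y) ↔ HasLogExpansion l e c C y := by
  rw [HasLogExpansion, HasLogExpansion, Real.log_neg_eq_log]

theorem self (l : ℝ) : HasLogExpansion l 1 0 0 l := by
  simp [HasLogExpansion]

theorem one_add {t : ℝ} (hl : 6 ≤ l) (hc : |(c : ℝ)| ≤ 1) (ht : |t - c / l| ≤ 3 / l ^ 2) :
    HasLogExpansion l 0 c 8 (1 + t) := by
  obtain ⟨q, hq⟩ : ∃ q, q = 1 / l := ⟨_, rfl⟩
  have hq₀ : 0 < q := hq ▸ by positivity
  have hq₁ : q ≤ 1 / 6 := hq ▸ one_div_le_one_div_of_le (by norm_num) hl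
  have hdiv (x : ℝ) : x / l ^ 2 = x * q ^ 2 := by rw [hq]; ring
  have hcq : |c / l| ≤ q := by
    rw [abs_div, abs_of_pos (by linarith : 0 < l), hq]
    gcongr
  rw [hdiv] at ht
  have htq : |t| ≤ 3 / 2 * q := by nlinarith [abs_sub_abs_le_abs_sub t (c / l)]
  have hsq : t ^ 2 ≤ 9 / 4 * q ^ 2 := by
    calc t ^ 2 = |t| ^ 2 := (sq_abs t).symm
      _ ≤ (3 / 2 * q) ^ 2 := by gcongr
      _ = 9 / 4 * q ^ 2 := by ring
  have hpos : 0 < 1 + t := by linarith [neg_abs_le t]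
  have hupper : Real.log (1 + t) ≤ t := by linarith [Real.log_le_sub_one_of_pos hpos]
  have hlower : t - 2 * t ^ 2 ≤ Real.log (1 + t) := by
    refine le_trans ?_ (Real.one_sub_inv_le_log_of_pos hpos)
    rw [← sub_nonneg]
    have : 1 - (1 + t)⁻¹ - (t - 2 * t ^ 2) = t ^ 2 * (1 + 2 * t) / (1 + t) := by
      field_simp
      ring
    rw [this]
    have : 0 ≤ 1 + 2 * t := by linarith [neg_abs_le t]
    positivity
  rw [HasLogExpansion, hdiv, Int.cast_zero, zero_mul, zero_add]
  rw [abs_le] at ht ⊢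
  constructor <;> linarith

theorem add_of_abs_sub_le {z : ℝ} (hl : 6 ≤ l) (hc : |(c : ℝ)| ≤ 1) (hz : |z - c| ≤ 3 / l) :
    HasLogExpansion l 1 c 8 (l + z) := by
  have hl₀ : 0 < l := by linarith
  have ht : |z / l - c / l| ≤ 3 / l ^ 2 := by
    rw [← sub_div, abs_div, abs_of_pos hl₀, sq, ← div_div]
    gcongr
  have hlz : l + z = l * (1 + z / l) := by field_simp
  have hne : 1 + z / l ≠ 0 := by
    intro h0
    rw [h0, mul_zero] at hlz
    have : 3 / l ≤ 1 / 2 := by rw [div_le_div_iff₀] <;> linarith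
    linarith [abs_le.1 hz, abs_le.1 hc]
  rw [hlz]
  simpa using (self l).mul (one_add hl hc ht) hl₀.ne' hne

end HasLogExpansion

end LogExpansion

section RootExpansions

/-- The growth exponents of the conjugates of `ε_l` with respect to `l`. -/
def expRoot : Fin 3 → ℤ := ![-1, 0, 1]

/-- The coefficients of `1 / l` in the logarithms of the conjugates of `ε_l`. -/
def coeffRoot : Fin 3 → ℤ := ![-1, 1, 0]

/-- The growth exponents of the conjugates of `ε_l - 1` with respect to `l`. -/
def expSubOne : Fin 3 → ℤ := ![0, -1, 1]

/-- The coefficients of `1 / l` in the logarithms of the conjugates of `ε_l - 1`. -/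
def coeffSubOne : Fin 3 → ℤ := ![1, -2, 1]

variable {l : ℕ} {φ : Fin 3 → EnnolaField l →ₐ[ℚ] ℝ}

theorem map_ennolaRoot_ne_zero (φ : EnnolaField l →ₐ[ℚ] ℝ) : φ (ennolaRoot l) ≠ 0 :=
  left_ne_zero_of_mul_eq_one (map_ennolaRoot_mul φ)

theorem map_ennolaRoot_sub_one_ne_zero (φ : EnnolaField l →ₐ[ℚ] ℝ) :
    φ (ennolaRoot l) - 1 ≠ 0 :=
  left_ne_zero_of_mul (right_ne_zero_of_mul_eq_one (map_ennolaRoot_mul φ))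

theorem map_ennolaRoot_add_ne_zero (φ : EnnolaField l →ₐ[ℚ] ℝ) :
    φ (ennolaRoot l) + l ≠ 0 :=
  right_ne_zero_of_mul (right_ne_zero_of_mul_eq_one (map_ennolaRoot_mul φ))

namespace LocatesRoots

theorem hasLogExpansion_zero (h : LocatesRoots φ) (hl : 6 ≤ l) :
    HasLogExpansion l (-1) (-1) 16 (φ 0 (ennolaRoot l)) ∧
      HasLogExpansion l 0 1 8 (φ 0 (ennolaRoot l) - 1) := by
  have hl' : (6 : ℝ) ≤ l := by exact_mod_cast hl
  obtain ⟨hlow, hupp⟩ := h.near_zero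
  have hgap : 1 / (l : ℝ) - 1 / (l + 1) ≤ 3 / (l : ℝ) ^ 2 := by
    rw [div_sub_div _ _ (by positivity) (by positivity), div_le_div_iff₀] <;> nlinarith
  have hpos : 0 < 1 / ((l : ℝ) + 1) := by positivity
  have hdiv : 3 / (l : ℝ) = 3 * (1 / l) := by ring
  have hsub : HasLogExpansion l 0 1 8 (φ 0 (ennolaRoot l) - 1) := by
    rw [← HasLogExpansion.neg_iff, neg_sub, sub_eq_add_neg]
    refine HasLogExpansion.one_add hl' (by simp) ?_
    rw [Int.cast_one, abs_le]
    constructor <;> linarith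
  have hadd : HasLogExpansion l 1 0 8 (φ 0 (ennolaRoot l) + l) := by
    rw [add_comm]
    refine HasLogExpansion.add_of_abs_sub_le hl' (by simp) ?_
    rw [Int.cast_zero, sub_zero, abs_le, hdiv]
    constructor <;> linarith
  have hprod : (φ 0 (ennolaRoot l) - 1) * (φ 0 (ennolaRoot l) + l) * φ 0 (ennolaRoot l) = 1 := by
    rw [mul_comm, map_ennolaRoot_mul]
  have hroot := (hsub.mul hadd (map_ennolaRoot_sub_one_ne_zero _)
    (map_ennolaRoot_add_ne_zero _)).of_mul_eq_one hprod
  norm_num at hroot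
  exact ⟨hroot, hsub⟩

theorem hasLogExpansion_one (h : LocatesRoots φ) (hl : 6 ≤ l) :
    HasLogExpansion l 0 1 8 (φ 1 (ennolaRoot l)) ∧
      HasLogExpansion l (-1) (-2) 16 (φ 1 (ennolaRoot l) - 1) := by
  have hl' : (6 : ℝ) ≤ l := by exact_mod_cast hl
  obtain ⟨hlow, hupp⟩ := h.near_one
  have hgap : 1 / (l : ℝ) - 1 / (l + 3) ≤ 3 / (l : ℝ) ^ 2 := by
    rw [div_sub_div _ _ (by positivity) (by positivity), div_le_div_iff₀] <;> nlinarith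
  have hpos : 0 < 1 / ((l : ℝ) + 3) := by positivity
  have hdiv : 3 / (l : ℝ) = 3 * (1 / l) := by ring
  have hroot : HasLogExpansion l 0 1 8 (φ 1 (ennolaRoot l)) := by
    rw [← add_sub_cancel 1 (φ 1 (ennolaRoot l))]
    refine HasLogExpansion.one_add hl' (by simp) ?_
    rw [Int.cast_one, abs_le]
    constructor <;> linarith
  have hadd : HasLogExpansion l 1 1 8 (φ 1 (ennolaRoot l) + l) := by
    rw [add_comm]
    refine HasLogExpansion.add_of_abs_sub_le hl' (by simp) ?_
    rw [Int.cast_one, abs_le, hdiv]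
    constructor <;> linarith
  have hprod : φ 1 (ennolaRoot l) * (φ 1 (ennolaRoot l) + l) * (φ 1 (ennolaRoot l) - 1) = 1 := by
    linear_combination map_ennolaRoot_mul (φ 1)
  have hsub := (hroot.mul hadd (map_ennolaRoot_ne_zero _)
    (map_ennolaRoot_add_ne_zero _)).of_mul_eq_one hprod
  norm_num at hsub
  exact ⟨hroot, hsub⟩

theorem hasLogExpansion_two (h : LocatesRoots φ) (hl : 6 ≤ l) :
    HasLogExpansion l 1 0 8 (φ 2 (ennolaRoot l)) ∧
      HasLogExpansion l 1 1 8 (φ 2 (ennolaRoot l) - 1) := by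
  have hl' : (6 : ℝ) ≤ l := by exact_mod_cast hl
  obtain ⟨hlow, hupp⟩ := h.near_neg
  have hsq : 1 / (l : ℝ) ^ 2 ≤ 3 / l := by rw [div_le_div_iff₀] <;> nlinarith
  constructor
  · rw [← HasLogExpansion.neg_iff,
      show -φ 2 (ennolaRoot l) = l + -(φ 2 (ennolaRoot l) + l) by ring]
    refine HasLogExpansion.add_of_abs_sub_le hl' (by simp) ?_
    rw [Int.cast_zero, abs_le]
    constructor <;> linarith
  · rw [← HasLogExpansion.neg_iff,
      show -(φ 2 (ennolaRoot l) - 1) = l + (1 - (φ 2 (ennolaRoot l) + l)) by ring]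
    refine HasLogExpansion.add_of_abs_sub_le hl' (by simp) ?_
    rw [Int.cast_one, abs_le]
    constructor <;> linarith

theorem hasLogExpansion_root (h : LocatesRoots φ) (hl : 6 ≤ l) (i : Fin 3) :
    HasLogExpansion l (expRoot i) (coeffRoot i) 16 (φ i (ennolaRoot l)) := by
  fin_cases i
  · exact (h.hasLogExpansion_zero hl).1
  · exact (h.hasLogExpansion_one hl).1.mono (by norm_num)
  · exact (h.hasLogExpansion_two hl).1.mono (by norm_num)

theorem hasLogExpansion_root_sub_one (h : LocatesRoots φ) (hl : 6 ≤ l) (i : Fin 3) :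
    HasLogExpansion l (expSubOne i) (coeffSubOne i) 16 (φ i (ennolaRoot l) - 1) := by
  fin_cases i
  · exact (h.hasLogExpansion_zero hl).2.mono (by norm_num)
  · exact (h.hasLogExpansion_one hl).2
  · exact (h.hasLogExpansion_two hl).2.mono (by norm_num)

end LocatesRoots

end RootExpansions

section Sizes

/-- The inequalities between a prime `p` and `τ = l ^ (1 / p)` under which the estimates hold. -/
structure IsScale (p : ℕ) (τ : ℝ) : Prop where
  two_le : 2 ≤ p
  le : 1000 * p ≤ τ

/-- `|x| = τ ^ n + (c / p) τ ^ (n - p) + O(τ ^ (n - 2p))` with `c = O(p)`: the size of a unit whose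
`p`-th power has growth exponent `n` in `l = τ ^ p`. -/
def HasSize (p : ℕ) (τ : ℝ) (n c : ℤ) (x : ℝ) : Prop :=
  |(c : ℝ)| ≤ 3 * p ∧ |(|x| - (τ ^ n + c / p * τ ^ (n - p)))| ≤ 50 * τ ^ (n - 2 * p)

/-- `x` is of exact order `τ ^ e`, with implied constants `a` and `b`. -/
def IsOfOrder (τ a b : ℝ) (e : ℤ) (x : ℝ) : Prop :=
  a * τ ^ e ≤ |x| ∧ |x| ≤ b * τ ^ e

namespace IsScale

variable {p : ℕ} {τ : ℝ}

theorem large (h : IsScale p τ) : 2000 ≤ τ := by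
  have : (2 : ℝ) ≤ p := by exact_mod_cast h.two_le
  linarith [h.le]

theorem pos (h : IsScale p τ) : 0 < τ := by linarith [h.large]

theorem one_le (h : IsScale p τ) : 1 ≤ τ := by linarith [h.large]

theorem natCast_pos (h : IsScale p τ) : (0 : ℝ) < p := by
  exact_mod_cast (by linarith [h.two_le] : 0 < p)

theorem zpow_le_zpow (h : IsScale p τ) {m n : ℤ} (hmn : m ≤ n) : τ ^ m ≤ τ ^ n :=
  zpow_le_zpow_right₀ h.one_le hmn

theorem mul_zpow_le_zpow (h : IsScale p τ) {m n : ℤ} (hmn : m < n) : 2000 * τ ^ m ≤ τ ^ n :=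
  calc 2000 * τ ^ m ≤ τ * τ ^ m := by gcongr; exacts [(zpow_pos h.pos m).le, h.large]
    _ = τ ^ (m + 1) := by rw [zpow_add_one₀ h.pos.ne', mul_comm]
    _ ≤ τ ^ n := h.zpow_le_zpow hmn

theorem abs_div_le (h : IsScale p τ) {c : ℝ} {k : ℝ} (hc : |c| ≤ k * p) : |c / p| ≤ k := by
  rwa [abs_div, abs_of_pos h.natCast_pos, div_le_iff₀ h.natCast_pos]

end IsScale

theorem abs_exp_sub_one_add_le {d s q : ℝ} (hq : q ≤ 1 / 32) (hs : |s| ≤ 3 * q)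
    (hds : |d - s| ≤ 32 * q ^ 2) : |Real.exp d - (1 + s)| ≤ 50 * q ^ 2 := by
  have hd : |d| ≤ 4 * q := by
    nlinarith [abs_sub_abs_le_abs_sub d s, abs_nonneg s]
  have hexp := Real.abs_exp_sub_one_sub_id_le (by linarith : |d| ≤ 1)
  have hd2 : d ^ 2 ≤ 16 * q ^ 2 := by
    calc d ^ 2 = |d| ^ 2 := (sq_abs d).symm
      _ ≤ (4 * q) ^ 2 := by gcongr
      _ = 16 * q ^ 2 := by ring
  calc |Real.exp d - (1 + s)| = |(Real.exp d - 1 - d) + (d - s)| := by ring_nf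
    _ ≤ |Real.exp d - 1 - d| + |d - s| := abs_add_le _ _
    _ ≤ 50 * q ^ 2 := by linarith [sq_nonneg q]

theorem HasLogExpansion.hasSize {p : ℕ} {τ : ℝ} (h : IsScale p τ) {n c : ℤ} {x : ℝ} (hx₀ : x ≠ 0)
    (hc : |(c : ℝ)| ≤ 3 * p) (hx : HasLogExpansion (τ ^ p) n c (32 * p) (x ^ p)) :
    HasSize p τ n c x := by
  have hp := h.natCast_pos
  obtain ⟨q, hq⟩ : ∃ q, q = τ ^ (-p : ℤ) := ⟨_, rfl⟩
  have hinv : τ ^ p = q⁻¹ := by rw [hq, zpow_neg, inv_inv, zpow_natCast]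
  have hq₀ : 0 < q := hq ▸ zpow_pos h.pos _
  have hq₁ : q ≤ 1 / 32 := by
    have := h.mul_zpow_le_zpow (by have := h.two_le; lia : (-p : ℤ) < 0)
    rw [zpow_zero, ← hq] at this
    linarith
  have hs : |c / p * q| ≤ 3 * q := by
    rw [abs_mul, abs_of_pos hq₀]
    gcongr
    exact h.abs_div_le hc
  have hd : |Real.log x - n * Real.log τ - c / p * q| ≤ 32 * q ^ 2 := by
    refine le_of_mul_le_mul_left ?_ hp
    calc (p : ℝ) * |Real.log x - n * Real.log τ - c / p * q|
        = |Real.log (x ^ p) - (n * Real.log (τ ^ p) + c / τ ^ p)| := by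
          rw [Real.log_pow, Real.log_pow, hinv, ← abs_of_pos hp, ← abs_mul, abs_of_pos hp]
          congr 1
          field_simp
          ring
      _ ≤ 32 * p / (τ ^ p) ^ 2 := hx
      _ = p * (32 * q ^ 2) := by rw [hinv]; field_simp
  have hexp : |x| = τ ^ n * Real.exp (Real.log x - n * Real.log τ) := by
    rw [Real.exp_sub, Real.exp_log_eq_abs hx₀, mul_comm (n : ℝ), Real.exp_mul,
      Real.exp_log h.pos, Real.rpow_intCast, mul_div_cancel₀ _ (zpow_pos h.pos n).ne']
  have hsub : τ ^ (n - p) = τ ^ n * q := by rw [hq, ← zpow_add₀ h.pos.ne', sub_eq_add_neg]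
  have hsub₂ : τ ^ (n - 2 * p) = τ ^ n * q ^ 2 := by
    rw [hq, ← zpow_natCast, ← zpow_mul, ← zpow_add₀ h.pos.ne']
    congr 1
    push_cast
    ring
  refine ⟨hc, ?_⟩
  calc |(|x| - (τ ^ n + c / p * τ ^ (n - p)))|
      = τ ^ n * |Real.exp (Real.log x - n * Real.log τ) - (1 + c / p * q)| := by
        rw [hexp, hsub, ← abs_of_pos (zpow_pos h.pos n), ← abs_mul, abs_of_pos (zpow_pos h.pos n)]
        ring_nf
    _ ≤ τ ^ n * (50 * q ^ 2) := by
        gcongr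
        · exact (zpow_pos h.pos n).le
        · exact abs_exp_sub_one_add_le hq₁ hs hd
    _ = 50 * τ ^ (n - 2 * p) := by rw [hsub₂]; ring

namespace IsOfOrder

variable {τ a a' b b' x : ℝ} {e : ℤ}

theorem mono (hτ : 0 < τ) (hx : IsOfOrder τ a b e x) (ha : a' ≤ a) (hb : b ≤ b') :
    IsOfOrder τ a' b' e x := by
  have := zpow_pos hτ e
  exact ⟨le_trans (by gcongr) hx.1, hx.2.trans (by gcongr)⟩

theorem const_mul (hx : IsOfOrder τ a b e x) (k : ℝ) :
    IsOfOrder τ (|k| * a) (|k| * b) e (k * x) := by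
  rw [IsOfOrder, abs_mul, mul_assoc, mul_assoc]
  exact ⟨by gcongr; exact hx.1, by gcongr; exact hx.2⟩

theorem ne_zero (hτ : 0 < τ) (ha : 0 < a) (hx : IsOfOrder τ a b e x) : x ≠ 0 := by
  have := zpow_pos hτ e
  exact abs_pos.1 (lt_of_lt_of_le (by positivity) hx.1)

theorem mul {e' : ℤ} {y : ℝ} (hτ : 0 < τ) (ha' : 0 ≤ a') (hx : IsOfOrder τ a b e x)
    (hy : IsOfOrder τ a' b' e' y) : IsOfOrder τ (a * a') (b * b') (e + e') (x * y) := by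
  have := zpow_pos hτ e
  have := zpow_pos hτ e'
  rw [IsOfOrder, abs_mul, zpow_add₀ hτ.ne', mul_mul_mul_comm, mul_mul_mul_comm b]
  exact ⟨mul_le_mul hx.1 hy.1 (by positivity) (abs_nonneg x),
    mul_le_mul hx.2 hy.2 (abs_nonneg y) ((abs_nonneg x).trans hx.2)⟩

theorem add_of_mul_nonneg {y : ℝ} (hxy : 0 ≤ x * y) (hx : IsOfOrder τ a b e x)
    (hy : IsOfOrder τ a' b' e y) : IsOfOrder τ (a + a') (b + b') e (x + y) := by
  rw [IsOfOrder, (abs_add_eq_add_abs_iff x y).2 (mul_nonneg_iff.1 hxy), add_mul, add_mul]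
  exact ⟨add_le_add hx.1 hy.1, add_le_add hx.2 hy.2⟩

end IsOfOrder

theorem exists_units_mul_eq_abs (x : ℝ) : ∃ s : ℤˣ, (s : ℤ) * x = |x| := by
  rcases le_total 0 x with h | h
  · exact ⟨1, by simp [abs_of_nonneg h]⟩
  · exact ⟨-1, by simp [abs_of_nonpos h]⟩

theorem abs_units_mul (s : ℤˣ) (x : ℝ) : |(s : ℤ) * x| = |x| := by
  have hs : |((s : ℤ) : ℝ)| = 1 := by exact_mod_cast Int.isUnit_iff_abs_eq.1 s.isUnit
  rw [abs_mul, hs, one_mul]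

namespace HasSize

variable {p : ℕ} {τ : ℝ} {n c c' : ℤ} {x y : ℝ}

theorem abs_abs_sub_le (h : IsScale p τ) (hx : HasSize p τ n c x) :
    |(|x| - τ ^ n)| ≤ 4 * τ ^ (n - p) := by
  have hpos := zpow_pos h.pos (n - p)
  have hlt := h.mul_zpow_le_zpow (by have := h.two_le; lia : n - 2 * p < n - p)
  have hc : |c / p * τ ^ (n - p)| ≤ 3 * τ ^ (n - p) := by
    rw [abs_mul, abs_of_pos hpos]
    gcongr
    exact h.abs_div_le hx.1
  calc |(|x| - τ ^ n)|
      = |(|x| - (τ ^ n + c / p * τ ^ (n - p))) + c / p * τ ^ (n - p)| := by ring_nf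
    _ ≤ 50 * τ ^ (n - 2 * p) + 3 * τ ^ (n - p) := (abs_add_le _ _).trans (add_le_add hx.2 hc)
    _ ≤ 4 * τ ^ (n - p) := by linarith

theorem isOfOrder (h : IsScale p τ) (hx : HasSize p τ n c x) : IsOfOrder τ (1 / 2) 2 n x := by
  have habs := abs_le.1 (hx.abs_abs_sub_le h)
  have hpos := zpow_pos h.pos n
  have hlt := h.mul_zpow_le_zpow (by have := h.two_le; lia : n - p < n)
  constructor <;> linarith

theorem ne_zero (h : IsScale p τ) (hx : HasSize p τ n c x) : x ≠ 0 :=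
  (hx.isOfOrder h).ne_zero h.pos (by norm_num)

theorem abs_abs_sub_abs_sub_le (hx : HasSize p τ n c x) (hy : HasSize p τ n c' y) :
    |(|x| - |y| - (c - c') / p * τ ^ (n - p))| ≤ 100 * τ ^ (n - 2 * p) := by
  have hx' := abs_le.1 hx.2
  have hy' := abs_le.1 hy.2
  have hdiv : (c - c') / p * τ ^ (n - p) = c / p * τ ^ (n - p) - c' / p * τ ^ (n - p) := by ring
  rw [abs_le, hdiv]
  constructor <;> linarith

theorem abs_abs_sub_abs_le (h : IsScale p τ) (hx : HasSize p τ n c x) (hy : HasSize p τ n c' y) :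
    |(|x| - |y|)| ≤ 8 * τ ^ (n - p) := by
  have hx' := abs_le.1 (hx.abs_abs_sub_le h)
  have hy' := abs_le.1 (hy.abs_abs_sub_le h)
  rw [abs_le]
  constructor <;> linarith

theorem abs_sub_le_of_mul_nonneg (h : IsScale p τ) (hxy : 0 ≤ x * y) (hx : HasSize p τ n c x)
    (hy : HasSize p τ n c' y) : |x - y| ≤ 8 * τ ^ (n - p) := by
  refine le_trans (le_of_eq ?_) (hx.abs_abs_sub_abs_le h hy)
  rcases mul_nonneg_iff.1 hxy with ⟨hx₀, hy₀⟩ | ⟨hx₀, hy₀⟩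
  · rw [abs_of_nonneg hx₀, abs_of_nonneg hy₀]
  · rw [abs_of_nonpos hx₀, abs_of_nonpos hy₀, abs_sub_comm]
    ring_nf

theorem isOfOrder_sub_of_mul_neg (h : IsScale p τ) (hxy : x * y < 0) (hx : HasSize p τ n c x)
    (hy : HasSize p τ n c' y) : IsOfOrder τ 1 4 n (x - y) := by
  have hy' := (hy.isOfOrder h).const_mul (-1)
  rw [neg_one_mul, abs_neg, abs_one, one_mul, one_mul] at hy'
  rw [sub_eq_add_neg]
  refine ((hx.isOfOrder h).add_of_mul_nonneg (by linarith) hy').mono h.pos ?_ ?_ <;> norm_num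

theorem units_mul (s : ℤˣ) (hx : HasSize p τ n c x) : HasSize p τ n c ((s : ℤ) * x) := by
  rw [HasSize, abs_units_mul]
  exact hx

end HasSize

end Sizes

section IntegerSums

variable {ι : Type*} [Fintype ι] {τ a b R : ℝ} {t : ι → ℝ} {e : ι → ℤ} {E : ℤ}

theorem exists_abs_sum_add_sub_le (hτ : 1 ≤ τ) (hb : 0 ≤ b) (he : Function.Injective e)
    (ht : ∀ i, t i = 0 ∨ IsOfOrder τ a b (e i) (t i)) (hR : |R| ≤ b * τ ^ E)
    (hE : ∃ i, t i ≠ 0 ∧ E < e i) :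
    ∃ i, t i ≠ 0 ∧ |∑ j, t j + R - t i| ≤ Fintype.card ι * (b * τ ^ (e i - 1)) := by
  classical
  obtain ⟨i₁, hi₁, hEi₁⟩ := hE
  obtain ⟨i, hi, hmax⟩ := Finset.exists_max_image {j | t j ≠ 0} e ⟨i₁, by simpa using hi₁⟩
  simp only [Finset.mem_filter, Finset.mem_univ, true_and] at hi hmax
  have hpow {k : ℤ} (hk : k < e i) : b * τ ^ k ≤ b * τ ^ (e i - 1) :=
    mul_le_mul_of_nonneg_left (zpow_le_zpow_right₀ hτ (by lia)) hb
  have hterm : ∀ j ∈ Finset.univ.erase i, |t j| ≤ b * τ ^ (e i - 1) := fun j hj ↦ by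
    rcases eq_or_ne (t j) 0 with hj₀ | hj₀
    · rw [hj₀, abs_zero]
      have := zpow_pos (zero_lt_one.trans_le hτ) (e i - 1)
      positivity
    · refine ((ht j).resolve_left hj₀).2.trans (hpow ?_)
      exact (hmax j hj₀).lt_of_ne (he.ne (Finset.ne_of_mem_erase hj))
  have hsum : |∑ j ∈ Finset.univ.erase i, t j| ≤ (Fintype.card ι - 1) * (b * τ ^ (e i - 1)) := by
    refine (Finset.abs_sum_le_sum_abs _ _).trans
      ((Finset.sum_le_card_nsmul _ _ _ hterm).trans_eq ?_)
    rw [nsmul_eq_mul, Finset.cast_card_erase_of_mem (Finset.mem_univ i), Finset.card_univ]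
  refine ⟨i, hi, ?_⟩
  rw [← Finset.add_sum_erase _ t (Finset.mem_univ i)]
  calc |t i + ∑ j ∈ Finset.univ.erase i, t j + R - t i|
      = |∑ j ∈ Finset.univ.erase i, t j + R| := by ring_nf
    _ ≤ (Fintype.card ι - 1) * (b * τ ^ (e i - 1)) + b * τ ^ (e i - 1) :=
        (abs_add_le _ _).trans (add_le_add hsum (hR.trans (hpow (hEi₁.trans_le (hmax i₁ hi₁)))))
    _ = Fintype.card ι * (b * τ ^ (e i - 1)) := by ring

theorem intCast_ne_sum_add (hτ : 1 ≤ τ) (hb : 0 ≤ b) (he : Function.Injective e)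
    (ht : ∀ i, t i = 0 ∨ IsOfOrder τ a b (e i) (t i)) (hneg : ∀ i, e i < 0)
    (hR : |R| ≤ b * τ ^ E) (hE : ∃ i, t i ≠ 0 ∧ E < e i) (hbτ : (Fintype.card ι + 1) * b < τ)
    (hab : Fintype.card ι * b < a * τ) (F : ℤ) : (F : ℝ) ≠ ∑ i, t i + R := by
  intro hF
  have hτ₀ : 0 < τ := by linarith
  obtain ⟨i, hi, hdom⟩ := exists_abs_sum_add_sub_le hτ hb he ht hR hE
  obtain ⟨hlow, hupp⟩ := (ht i).resolve_left hi
  rw [← hF] at hdom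
  have hzero : F ≠ 0 := by
    rintro rfl
    have hpos := zpow_pos hτ₀ (e i - 1)
    have hpow : τ ^ e i = τ * τ ^ (e i - 1) := by rw [← zpow_one_add₀ hτ₀.ne', add_sub_cancel]
    rw [Int.cast_zero, zero_sub, abs_neg] at hdom
    rw [hpow] at hlow
    nlinarith
  have hlt : |(F : ℝ)| < 1 := by
    have hpow {k : ℤ} (hk : k ≤ -1) : τ ^ k ≤ τ⁻¹ := by
      rw [← zpow_neg_one]
      exact zpow_le_zpow_right₀ hτ hk
    calc |(F : ℝ)| = |t i + (F - t i)| := by rw [add_sub_cancel]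
      _ ≤ b * τ ^ e i + Fintype.card ι * (b * τ ^ (e i - 1)) :=
          (abs_add_le _ _).trans (add_le_add hupp hdom)
      _ ≤ b * τ⁻¹ + Fintype.card ι * (b * τ⁻¹) := by
          gcongr <;> exact hpow (by have := hneg i; lia)
      _ = (Fintype.card ι + 1) * b / τ := by ring
      _ < 1 := (div_lt_one hτ₀).2 hbτ
  exact hzero (Int.abs_lt_one_iff.1 (by exact_mod_cast hlt))

end IntegerSums

section Contradictions

variable {p : ℕ} {τ : ℝ} {n n' c c' : Fin 3 → ℤ} {x x' : Fin 3 → ℝ}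

theorem intCast_ne_sum_of_hasSize_natCast (h : IsScale p τ) (hp : 3 ≤ p) {l : ℕ} (hl : τ ^ p = l)
    (hx : ∀ i, HasSize p τ ((![p, -1, 1 - p] : Fin 3 → ℤ) i) (c i) (x i)) (t : ℤ) :
    (t : ℝ) ≠ ∑ i, x i := by
  intro ht
  have hp₀ := h.natCast_pos
  obtain ⟨s, hs⟩ := exists_units_mul_eq_abs (x 0)
  refine intCast_ne_sum_add (t := fun i : Fin 2 ↦ p * ((s : ℤ) * x i.succ)) (e := ![-1, 1 - p])
    (a := p / 2) (b := 50 * p) (R := p * (|x 0| - (l + c 0 / p))) (E := -p)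
    h.one_le (by positivity) ?_ (fun i ↦ Or.inr ?_) ?_ ?_ ⟨0, ?_, ?_⟩ ?_ ?_
    (s * p * t - p * l - c 0) ?_
  · intro i j
    fin_cases i <;> fin_cases j <;> simp <;> lia
  · have hi := ((hx i.succ).units_mul s).isOfOrder h |>.const_mul p
    rw [abs_of_pos hp₀] at hi
    exact hi.mono h.pos (by linarith) (by linarith)
  · intro i
    fin_cases i <;> simp; lia
  · have h₀ := (hx 0).2
    simp only [Matrix.cons_val_zero, sub_self, zpow_zero, mul_one, zpow_natCast, hl] at h₀
    rw [abs_mul, abs_of_pos hp₀, mul_comm (50 : ℝ), mul_assoc]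
    gcongr
    exact h₀.trans_eq (by congr 2; ring)
  · exact mul_ne_zero hp₀.ne' (((hx 1).units_mul s).ne_zero h)
  · change (-p : ℤ) < -1
    lia
  · norm_num
    linarith [h.le]
  · norm_num
    nlinarith [h.large]
  · rw [Fin.sum_univ_two]
    push_cast
    rw [ht, Fin.sum_univ_three, mul_sub, ← hs]
    field_simp
    ring

theorem false_of_hasSize_one_one_of_mul_pos (h : IsScale p τ)
    (hx : ∀ i, HasSize p τ (![1, 1, -2] i) (c i) (x i)) (hpos : 0 < x 0 * x 1) {t t₂ : ℤ}
    (ht : (t : ℝ) = ∑ i, x i) (ht₂ : (t₂ : ℝ) = ∑ i, x i ^ 2) : False := by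
  -- As `x 0` and `x 1` have the same sign, their main terms cancel in
  -- `2 * t₂ - t ^ 2 = (x 0 - x 1) ^ 2 + x 2 ^ 2 - 2 * x 2 * (x 0 + x 1)`.
  have hx₀ : HasSize p τ 1 (c 0) (x 0) := hx 0
  have hx₁ : HasSize p τ 1 (c 1) (x 1) := hx 1
  have hx₂ : HasSize p τ (-2) (c 2) (x 2) := hx 2
  have hord : IsOfOrder τ 1 68 (-1) (-2 * x 2 * (x 0 + x 1)) := by
    have hadd := (hx₀.isOfOrder h).add_of_mul_nonneg hpos.le (hx₁.isOfOrder h)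
    refine (((hx₂.isOfOrder h).const_mul (-2)).mul h.pos (by norm_num) hadd).mono
      h.pos ?_ ?_ <;> norm_num
  have hsub : (x 0 - x 1) ^ 2 ≤ (8 * τ ^ (-1 : ℤ)) ^ 2 := by
    refine sq_le_sq.2 <|
      ((hx₀.abs_sub_le_of_mul_nonneg h hpos.le hx₁).trans ?_).trans (le_abs_self _)
    gcongr
    · exact h.one_le
    · have := h.two_le
      lia
  have hsq : x 2 ^ 2 ≤ (2 * τ ^ (-1 : ℤ)) ^ 2 := by
    refine sq_le_sq.2 (((hx₂.isOfOrder h).2.trans ?_).trans (le_abs_self _))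
    gcongr
    · exact h.one_le
    · norm_num
  refine intCast_ne_sum_add (t := fun _ : Unit ↦ -2 * x 2 * (x 0 + x 1)) (e := fun _ ↦ -1)
    (a := 1) (b := 68) (R := (x 0 - x 1) ^ 2 + x 2 ^ 2) (E := -2) h.one_le (by norm_num)
    (Function.injective_of_subsingleton _) (fun _ ↦ Or.inr hord) (by simp) ?_
    ⟨(), hord.ne_zero h.pos one_pos, by norm_num⟩ (by norm_num; linarith [h.large])
    (by norm_num; linarith [h.large]) (2 * t₂ - t ^ 2) ?_
  · rw [abs_of_nonneg (by positivity)]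
    refine (add_le_add hsub hsq).trans_eq ?_
    rw [mul_pow, mul_pow, ← zpow_natCast (τ ^ (-1 : ℤ)), ← zpow_mul]
    norm_num
    ring
  · rw [Fintype.sum_unique]
    push_cast
    rw [ht, ht₂, Fin.sum_univ_three, Fin.sum_univ_three]
    ring

theorem isOfOrder_sub_div_mul_zpow (h : IsScale p τ) {c c' : ℤ} (hc : |(c : ℝ)| ≤ 3 * p)
    (hc' : |(c' : ℝ)| ≤ 3 * p) (hne : c ≠ c') (e : ℤ) :
    IsOfOrder τ (1 / p) 6 e ((c - c') / p * τ ^ e) := by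
  have hpos := zpow_pos h.pos e
  rw [IsOfOrder, abs_mul, abs_of_pos hpos]
  constructor
  · gcongr
    rw [abs_div, abs_of_pos h.natCast_pos]
    gcongr
    exact_mod_cast Int.one_le_abs (sub_ne_zero.2 hne)
  · gcongr
    exact h.abs_div_le ((abs_sub _ _).trans (by linarith))

theorem intCast_ne_abs_sub_abs_add_sum (h : IsScale p τ) {m d d' E : ℤ} {y y' R : ℝ} {k : ℕ}
    (hk : k ≤ 4) {t : Fin k → ℝ} {e : Fin k → ℤ}
    (hinj : Function.Injective (Matrix.vecCons (m - p) e))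
    (hy : HasSize p τ m d y) (hy' : HasSize p τ m d' y')
    (ht : ∀ i, t i = 0 ∨ IsOfOrder τ (1 / 2) 4 (e i) (t i)) (hm : m < p) (hneg : ∀ i, e i < 0)
    (hR : |R| ≤ 16 * τ ^ E) (hmE : m - 2 * p ≤ E)
    (hE : d ≠ d' ∧ E < m - p ∨ ∃ i, t i ≠ 0 ∧ E < e i) (F : ℤ) :
    (F : ℝ) ≠ |y| - |y'| + ∑ i, t i + R := by
  have hp₀ := h.natCast_pos
  have hp₂ : (1 : ℝ) / p ≤ 1 / 2 :=
    one_div_le_one_div_of_le two_pos (by exact_mod_cast h.two_le)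
  have hk' : (k : ℝ) ≤ 4 := by exact_mod_cast hk
  have hcoeff (hd : d ≠ d') := isOfOrder_sub_div_mul_zpow h hy.1 hy'.1 hd (m - p)
  have hR' : |(|y| - |y'| - (d - d') / p * τ ^ (m - p)) + R| ≤ 116 * τ ^ E :=
    calc _ ≤ 100 * τ ^ (m - 2 * p) + 16 * τ ^ E :=
          (abs_add_le _ _).trans (add_le_add (hy.abs_abs_sub_abs_sub_le hy') hR)
      _ ≤ 116 * τ ^ E := by linarith [h.zpow_le_zpow hmE]
  have hterm : ∀ i, Matrix.vecCons ((d - d') / p * τ ^ (m - p)) t i = 0 ∨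
      IsOfOrder τ (1 / p) 116 (Matrix.vecCons (m - p) e i)
        (Matrix.vecCons ((d - d') / p * τ ^ (m - p)) t i) := by
    refine Fin.cases ?_ fun i ↦ ?_
    · rcases eq_or_ne d d' with rfl | hd
      · simp
      · exact Or.inr ((hcoeff hd).mono h.pos le_rfl (by norm_num))
    · exact (ht i).imp_right fun hi ↦ hi.mono h.pos hp₂ (by norm_num)
  have hlead : ∃ i, Matrix.vecCons ((d - d') / p * τ ^ (m - p)) t i ≠ 0 ∧
      E < Matrix.vecCons (m - p) e i := by
    rcases hE with ⟨hd, hE⟩ | ⟨i, hi, hE⟩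
    · exact ⟨0, (hcoeff hd).ne_zero h.pos (one_div_pos.2 hp₀), hE⟩
    · exact ⟨i.succ, hi, hE⟩
  convert intCast_ne_sum_add h.one_le (by norm_num) hinj hterm
    (Fin.cases (by simpa using hm) hneg) hR' hlead ?_ ?_ F using 1
  · rw [Fin.sum_univ_succ]
    simp only [Matrix.cons_val_zero, Matrix.cons_val_succ]
    ring
  · rw [Fintype.card_fin]
    push_cast
    linarith [h.large]
  · rw [Fintype.card_fin, div_mul_eq_mul_div, one_mul, lt_div_iff₀ hp₀]
    push_cast
    nlinarith [h.le]

theorem intCast_ne_sum_of_hasSize_one_one_of_mul_neg (h : IsScale p τ) (hp : p ≠ 3)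
    (hx : ∀ i, HasSize p τ (![1, 1, -2] i) (c i) (x i)) (hneg : x 0 * x 1 < 0) (hc : c 0 ≠ c 1)
    (t : ℤ) : (t : ℝ) ≠ ∑ i, x i := by
  intro ht
  have hp₂ := h.two_le
  obtain ⟨s, hs⟩ : ∃ s : ℤˣ, (s : ℤ) * (x 0 + x 1) = |x 0| - |x 1| := by
    rcases mul_neg_iff.1 hneg with ⟨hx₀, hx₁⟩ | ⟨hx₀, hx₁⟩
    · exact ⟨1, by simp [abs_of_pos hx₀, abs_of_neg hx₁]⟩
    · exact ⟨-1, by simp [abs_of_neg hx₀, abs_of_pos hx₁]; ring⟩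
  refine intCast_ne_abs_sub_abs_add_sum h (m := 1) (d := c 0) (d' := c 1) (e := ![-2])
    (t := ![(s : ℤ) * x 2]) (R := 0) (E := 1 - 2 * p) (by norm_num) ?_ (hx 0) (hx 1)
    (fun i ↦ Or.inr ?_) (by lia) (by simp) ?_ le_rfl (Or.inl ⟨hc, ?_⟩) (s * t) ?_
  · intro i j
    fin_cases i <;> fin_cases j <;> simp <;> lia
  · rw [Subsingleton.elim i 0]
    exact (((hx 2).units_mul s).isOfOrder h).mono h.pos le_rfl (by norm_num)
  · have := zpow_pos h.pos (1 - 2 * p)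
    rw [abs_zero]
    positivity
  · lia
  · push_cast
    rw [ht, Fin.sum_univ_three, mul_add, hs]
    simp

theorem false_of_hasSize_of_injective (h : IsScale p τ) (hnp : n 0 < p) (hpn : -p < n 1)
    (hn : ∀ i, i ≠ 0 → n i < 0) (hn' : ∀ i, i ≠ 0 → n' i < 0) (hn₀ : n' 0 = n 0)
    (hinj : Function.Injective ![n 0 - p, n 1, n 2, n' 1, n' 2])
    (hx : ∀ i, HasSize p τ (n i) (c i) (x i)) (hx' : ∀ i, HasSize p τ (n' i) (c' i) (x' i))
    {t t' : ℤ} (ht : (t : ℝ) = ∑ i, x i) (ht' : (t' : ℝ) = ∑ i, x' i) : False := by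
  obtain ⟨s, hs⟩ := exists_units_mul_eq_abs (x 0)
  obtain ⟨s', hs'⟩ := exists_units_mul_eq_abs (x' 0)
  have hsize {m d : ℤ} {y : ℝ} (hy : HasSize p τ m d y) : IsOfOrder τ (1 / 2) 4 m y :=
    (hy.isOfOrder h).mono h.pos le_rfl (by norm_num)
  refine intCast_ne_abs_sub_abs_add_sum h (d := c 0) (d' := c' 0) (y := x 0) (y' := x' 0)
    (t := ![(s : ℤ) * x 1, (s : ℤ) * x 2, ((-s' : ℤˣ) : ℤ) * x' 1, ((-s' : ℤˣ) : ℤ) * x' 2])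
    (R := 0) (E := n 0 - 2 * p) le_rfl hinj (hx 0) (hn₀ ▸ hx' 0) ?_ hnp ?_ ?_ le_rfl
    (Or.inr ⟨0, ((hx 1).units_mul s).ne_zero h, ?_⟩) (s * t - s' * t') ?_
  · simp only [Fin.forall_fin_succ]
    exact ⟨Or.inr (hsize ((hx 1).units_mul s)), Or.inr (hsize ((hx 2).units_mul s)),
      Or.inr (hsize ((hx' 1).units_mul (-s'))), Or.inr (hsize ((hx' 2).units_mul (-s'))), nofun⟩
  · simp only [Fin.forall_fin_succ]
    exact ⟨hn 1 (by decide), hn 2 (by decide), hn' 1 (by decide), hn' 2 (by decide), nofun⟩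
  · have := zpow_pos h.pos (n 0 - 2 * p)
    rw [abs_zero]
    positivity
  · simp only [Matrix.cons_val_zero]
    lia
  · rw [Fin.sum_univ_four]
    push_cast
    rw [ht, ht', Fin.sum_univ_three, Fin.sum_univ_three, ← hs, ← hs']
    simp
    ring

theorem false_of_hasSize_of_coeff_ne (h : IsScale p τ) (hn₀ : 0 < n 0) (hnp : n 0 < p)
    (hn : ∀ i, i ≠ 0 → n i < 0) (hinj : Function.Injective ![n 0 - p, n 1, n 2])
    (hc : c 0 ≠ c' 0) (hx : ∀ i, HasSize p τ (n i) (c i) (x i))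
    (hx' : ∀ i, HasSize p τ (n i) (c' i) (x' i)) {t t' : ℤ} (ht : (t : ℝ) = ∑ i, x i)
    (ht' : (t' : ℝ) = ∑ i, x' i) : False := by
  obtain ⟨s, hs⟩ := exists_units_mul_eq_abs (x 0)
  obtain ⟨s', hs'⟩ := exists_units_mul_eq_abs (x' 0)
  have hsub {i : Fin 3} (hi : i ≠ 0) : ∃ g r : ℝ, (s : ℤ) * x i - (s' : ℤ) * x' i = g + r ∧
      |r| ≤ 8 * τ ^ (n 0 - p - 1) ∧ (g = 0 ∨ IsOfOrder τ (1 / 2) 4 (n i) g) := by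
    have hy := (hx i).units_mul s
    have hy' := (hx' i).units_mul s'
    have hpow := h.zpow_le_zpow (by have := hn i hi; lia : n i - p ≤ n 0 - p - 1)
    rcases le_or_gt 0 (((s : ℤ) * x i) * ((s' : ℤ) * x' i)) with hxx' | hxx'
    · refine ⟨0, _, (zero_add _).symm, ?_, Or.inl rfl⟩
      exact (hy.abs_sub_le_of_mul_nonneg h hxx' hy').trans (by linarith)
    · refine ⟨_, 0, (add_zero _).symm, ?_, Or.inr ?_⟩
      · have := zpow_pos h.pos (n 0 - p - 1)
        rw [abs_zero]
        positivity
      · exact (hy.isOfOrder_sub_of_mul_neg h hxx' hy').mono h.pos (by norm_num) le_rfl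
  obtain ⟨g, r, hgr, hr, hg⟩ := hsub (i := 1) (by decide)
  obtain ⟨g', r', hgr', hr', hg'⟩ := hsub (i := 2) (by decide)
  refine intCast_ne_abs_sub_abs_add_sum h (t := ![g, g']) (R := r + r') (E := n 0 - p - 1)
    (by norm_num) hinj (hx 0) (hx' 0) ?_ hnp ?_ ((abs_add_le _ _).trans (by linarith)) (by lia)
    (Or.inl ⟨hc, by lia⟩) (s * t - s' * t') ?_
  · simpa only [Fin.forall_fin_two] using ⟨hg, hg'⟩
  · simpa only [Fin.forall_fin_two] using ⟨hn 1 (by decide), hn 2 (by decide)⟩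
  · rw [Fin.sum_univ_two]
    push_cast
    rw [ht, ht', Fin.sum_univ_three, Fin.sum_univ_three, ← hs, ← hs']
    linear_combination hgr + hgr'

end Contradictions

section Realisation

variable {l p : ℕ} {τ : ℝ} {φ : Fin 3 → EnnolaField l →ₐ[ℚ] ℝ} {u : (𝓞 (EnnolaField l))ˣ}
  {n m : Fin 3 → ℤ}

/-- The second-order coefficients (the `c` of `HasLogExpansion`) of the conjugates of
`ε_l ^ (-m 0) * (ε_l - 1) ^ (-m 1)`. -/
def coeffExponents (m : Fin 3 → ℤ) (i : Fin 3) : ℤ :=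
  -m 0 * coeffRoot i + -m 1 * coeffSubOne i

theorem abs_coeffExponents_le (hm : ∀ i, |m i| ≤ p) (i : Fin 3) : |coeffExponents m i| ≤ 3 * p := by
  have h₀ := abs_le.1 (hm 0)
  have h₁ := abs_le.1 (hm 1)
  fin_cases i <;> simp [coeffExponents, coeffRoot, coeffSubOne, abs_le] <;> lia

theorem IsScale.six_le (h : IsScale p τ) (hl : τ ^ p = l) : 6 ≤ l := by
  have hτ : τ ≤ τ ^ p := le_self_pow₀ h.one_le (by have := h.two_le; lia)
  have : (6 : ℝ) ≤ l := by linarith [h.large]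
  exact_mod_cast this

namespace HasExponents

theorem sum_intCast_eq_zero (hu : HasExponents p u n) : ∑ i, (n i : ZMod p) = 0 := by
  exact_mod_cast congrArg (Int.cast : ℤ → ZMod p) hu.1

theorem coe_pow_eq_or_eq_neg (hu : HasExponents p u m) :
    (u : EnnolaField l) ^ p = ennolaRoot l ^ (-m 0) * (ennolaRoot l - 1) ^ (-m 1) ∨
      (u : EnnolaField l) ^ p = -(ennolaRoot l ^ (-m 0) * (ennolaRoot l - 1) ^ (-m 1)) := by
  rw [← sq_eq_sq_iff_eq_or_eq_neg]
  have hmap := congrArg (fun x ↦ (Units.map (algebraMap (𝓞 (EnnolaField l)) (EnnolaField l) :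
    𝓞 (EnnolaField l) →* EnnolaField l) x : EnnolaField l)) hu.2
  simpa [Units.val_zpow_eq_zpow_val, coe_ennolaUnit, coe_ennolaUnitSubOne] using hmap

theorem hasLogExpansion_map_pow (hu : HasExponents p u m) (hφ : LocatesRoots φ) (hl : 6 ≤ l)
    (hm : ∀ i, |m i| ≤ p) (i : Fin 3) :
    HasLogExpansion l (m i) (coeffExponents m i) (32 * p) (φ i u ^ p) := by
  have hlog := ((hφ.hasLogExpansion_root hl i).zpow (-m 0)).mul
    ((hφ.hasLogExpansion_root_sub_one hl i).zpow (-m 1))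
    (zpow_ne_zero _ (map_ennolaRoot_ne_zero (φ i)))
    (zpow_ne_zero _ (map_ennolaRoot_sub_one_ne_zero (φ i)))
  have hexp : -m 0 * expRoot i + -m 1 * expSubOne i = m i := by
    have hsum := hu.1
    rw [Fin.sum_univ_three] at hsum
    fin_cases i <;> simp [expRoot, expSubOne]
    lia
  have hC : ((|-m 0| : ℤ) : ℝ) * 16 + ((|-m 1| : ℤ) : ℝ) * 16 ≤ 32 * p := by
    have h₀ := hm 0
    have h₁ := hm 1
    rw [abs_neg, abs_neg]
    norm_cast
    lia
  rw [hexp, ← coeffExponents] at hlog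
  have hword := hlog.mono hC
  rw [← map_pow]
  rcases hu.coe_pow_eq_or_eq_neg with h | h
  · simpa [h] using hword
  · simpa [h] using HasLogExpansion.neg_iff.2 hword

theorem hasSize (hu : HasExponents p u m) (hφ : LocatesRoots φ) (h : IsScale p τ) (hl : τ ^ p = l)
    (hm : ∀ i, |m i| ≤ p) (i : Fin 3) : HasSize p τ (m i) (coeffExponents m i) (φ i u) := by
  refine HasLogExpansion.hasSize h (by simp) (by exact_mod_cast abs_coeffExponents_le hm i) ?_
  rw [hl]
  exact hu.hasLogExpansion_map_pow hφ (h.six_le hl) hm i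

theorem exists_hasSize (hu : HasExponents p u n) (hφ : LocatesRoots φ) (h : IsScale p τ)
    (hl : τ ^ p = l) (σ : Equiv.Perm (Fin 3)) {κ : ZMod p} (hm₀ : ∑ i, m i = 0)
    (hm : ∀ i, |m i| ≤ p) (hmn : ∀ i, (m i : ZMod p) = κ * n (σ i)) :
    ∃ v : (𝓞 (EnnolaField l))ˣ, HasExponents p v (m ∘ σ.symm) ∧
      ∀ i, HasSize p τ (m i) (coeffExponents (m ∘ σ.symm) (σ i)) (φ (σ i) v) := by
  obtain ⟨v, hv⟩ := hu.exists_of_eq_mul (m := m ∘ σ.symm) (κ := κ)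
    ((Equiv.sum_comp σ.symm m).trans hm₀) fun i ↦ by simpa using hmn (σ.symm i)
  refine ⟨v, hv, fun i ↦ ?_⟩
  simpa using hv.hasSize hφ h hl (fun j ↦ hm (σ.symm j)) (σ i)

end HasExponents

theorem LocatesRoots.exists_int_eq_sum_perm (hφ : LocatesRoots φ) (h : IsScale p τ) (hl : τ ^ p = l)
    (σ : Equiv.Perm (Fin 3)) (x : 𝓞 (EnnolaField l)) : ∃ t : ℤ, (t : ℝ) = ∑ i, φ (σ i) x :=
  have hl₃ : 3 ≤ l := le_trans (by norm_num) (h.six_le hl)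
  exists_int_eq_sum_real_embeddings ((hφ.injective hl₃).comp σ.injective)
    (by rw [finrank_ennolaField, Fintype.card_fin]) x

end Realisation

section EqualExponents

variable {l p : ℕ} {τ : ℝ} {φ : Fin 3 → EnnolaField l →ₐ[ℚ] ℝ} {u : (𝓞 (EnnolaField l))ˣ}
  {n c : Fin 3 → ℤ}

theorem exists_perm_apply_zero_apply_one {i j : Fin 3} (hij : i ≠ j) :
    ∃ σ : Equiv.Perm (Fin 3), σ 0 = i ∧ σ 1 = j := by
  revert i j
  decide

theorem coeffExponents_one_one_ne (σ : Equiv.Perm (Fin 3)) :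
    coeffExponents (![1, 1, -2] ∘ σ.symm) (σ 0) ≠ coeffExponents (![1, 1, -2] ∘ σ.symm) (σ 1) := by
  revert σ
  decide

theorem LocatesRoots.false_of_hasSize_one_one_of_mul_pos (hφ : LocatesRoots φ) (h : IsScale p τ)
    (hl : τ ^ p = l) (σ : Equiv.Perm (Fin 3))
    (hx : ∀ i, HasSize p τ (![1, 1, -2] i) (c i) (φ (σ i) u)) (hpos : 0 < φ (σ 0) u * φ (σ 1) u) :
    False := by
  obtain ⟨t, ht⟩ := hφ.exists_int_eq_sum_perm h hl σ u
  obtain ⟨t₂, ht₂⟩ := hφ.exists_int_eq_sum_perm h hl σ (u ^ 2 : 𝓞 (EnnolaField l))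
  exact _root_.false_of_hasSize_one_one_of_mul_pos h hx hpos ht (by simpa using ht₂)

namespace HasExponents

theorem mul_pos_of_three (hu : HasExponents 3 u ![1, 1, -2]) (hφ : LocatesRoots φ) :
    0 < φ 0 u * φ 1 u := by
  have hpow := hu.coe_pow_eq_or_eq_neg
  have h₀ := hφ.root_zero_neg
  have h₁ := hφ.one_lt_root_one
  have hw₀ : 0 < φ 0 (ennolaRoot l) ^ (-1 : ℤ) * (φ 0 (ennolaRoot l) - 1) ^ (-1 : ℤ) := by
    rw [← mul_zpow]
    exact zpow_pos (mul_pos_of_neg_of_neg h₀ (by linarith)) _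
  have hw₁ : 0 < φ 1 (ennolaRoot l) ^ (-1 : ℤ) * (φ 1 (ennolaRoot l) - 1) ^ (-1 : ℤ) :=
    mul_pos (zpow_pos (by linarith) _) (zpow_pos (by linarith) _)
  have hcube : 0 < (φ 0 u * φ 1 u) ^ 3 := by
    rw [mul_pow, ← map_pow (φ 0), ← map_pow (φ 1)]
    rcases hpow with h | h
    · simpa [h] using mul_pos hw₀ hw₁
    · simpa [h] using mul_pos hw₀ hw₁
  exact (Odd.pow_pos_iff (by decide)).1 hcube

theorem false_of_three (hu : HasExponents 3 u n) (hφ : LocatesRoots φ) (h : IsScale 3 τ)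
    (hl : τ ^ 3 = l) (hn : (n 0 : ZMod 3) ≠ 0) (heq : ∀ i, (n i : ZMod 3) = n 0) : False := by
  obtain ⟨v, hv, hsize⟩ := hu.exists_hasSize hφ h hl 1 (m := ![1, 1, -2]) (κ := n 0)
    (by decide) (by decide) fun i ↦ by
      have hsq : ∀ a : ZMod 3, a ≠ 0 → a * a = 1 := by decide
      rw [Equiv.Perm.one_apply, heq i, hsq _ hn]
      revert i
      decide
  exact hφ.false_of_hasSize_one_one_of_mul_pos h hl 1 hsize (hv.mul_pos_of_three hφ)

theorem false_of_eq [Fact p.Prime] (hu : HasExponents p u n) (hφ : LocatesRoots φ)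
    (h : IsScale p τ) (hl : τ ^ p = l) {i j : Fin 3} (hij : i ≠ j) (hn : (n i : ZMod p) ≠ 0)
    (heq : (n i : ZMod p) = n j) : False := by
  obtain ⟨σ, rfl, rfl⟩ := exists_perm_apply_zero_apply_one hij
  have hsum : (n (σ 2) : ZMod p) = -2 * n (σ 0) := by
    have := (Equiv.sum_comp σ fun i ↦ (n i : ZMod p)).trans hu.sum_intCast_eq_zero
    rw [Fin.sum_univ_three, ← heq] at this
    linear_combination this
  by_cases hp : p = 3
  · subst hp
    have hn₀ (i) : (n i : ZMod 3) = n (σ 0) := by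
      obtain ⟨i, rfl⟩ := σ.surjective i
      fin_cases i
      exacts [rfl, heq.symm, hsum.trans (by rw [show (-2 : ZMod 3) = 1 from rfl, one_mul])]
    exact hu.false_of_three hφ h hl (hn₀ 0 ▸ hn) fun i ↦ (hn₀ i).trans (hn₀ 0).symm
  obtain ⟨v, -, hsize⟩ := hu.exists_hasSize hφ h hl σ (m := ![1, 1, -2])
    (κ := (n (σ 0) : ZMod p)⁻¹) (by decide)
    (fun i ↦ by have := h.two_le; fin_cases i <;> simp <;> lia) fun i ↦ by
      fin_cases i
      · simp [hn]
      · simp [← heq, hn]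
      · simp [hsum, mul_left_comm, hn]
  have hne : φ (σ 0) v * φ (σ 1) v ≠ 0 := mul_ne_zero ((hsize 0).ne_zero h) ((hsize 1).ne_zero h)
  obtain ⟨t, ht⟩ := hφ.exists_int_eq_sum_perm h hl σ v
  rcases hne.lt_or_gt with hneg | hpos
  · exact intCast_ne_sum_of_hasSize_one_one_of_mul_neg h hp hsize hneg
      (coeffExponents_one_one_ne σ) t ht
  · exact hφ.false_of_hasSize_one_one_of_mul_pos h hl σ hsize hpos

theorem false_of_eq_zero [Fact p.Prime] (hu : HasExponents p u n) (hφ : LocatesRoots φ)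
    (h : IsScale p τ) (hl : τ ^ p = l) {i j : Fin 3} (hi : (n i : ZMod p) = 0)
    (hj : (n j : ZMod p) ≠ 0) : False := by
  obtain ⟨σ, rfl, rfl⟩ := exists_perm_apply_zero_apply_one (ne_of_apply_ne (fun i ↦ (n i : ZMod p))
    (hi.trans_ne hj.symm))
  have hsum : (n (σ 2) : ZMod p) = -n (σ 1) := by
    have := (Equiv.sum_comp σ fun i ↦ (n i : ZMod p)).trans hu.sum_intCast_eq_zero
    rw [Fin.sum_univ_three, hi] at this
    linear_combination this
  rcases h.two_le.eq_or_lt with rfl | hp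
  · exact hu.false_of_eq hφ h hl (σ.injective.ne (by decide : (1 : Fin 3) ≠ 2)) hj
      (by rw [hsum, ZMod.neg_eq_self_mod_two])
  obtain ⟨v, -, hsize⟩ := hu.exists_hasSize hφ h hl σ (m := ![p, -1, 1 - p])
    (κ := -(n (σ 1) : ZMod p)⁻¹) (by simp [Fin.sum_univ_three]; ring)
    (fun i ↦ by fin_cases i <;> simp [abs_le] <;> lia) fun i ↦ by
      fin_cases i
      · simp [hi]
      · simp [hj]
      · simp [hsum, hj]
  obtain ⟨t, ht⟩ := hφ.exists_int_eq_sum_perm h hl σ v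
  exact intCast_ne_sum_of_hasSize_natCast h hp hl hsize t ht

end HasExponents

end EqualExponents

section ResidueSums

variable {p : ℕ} {r : Fin 3 → ZMod p}

/-- The sum of the representatives in `[0, p)` of the entries of `r`. If the entries sum to zero
modulo `p`, it tells how many of them have to be lowered by `p` to get integers with sum zero. -/
def residueSum (r : Fin 3 → ZMod p) : ℕ := ∑ i, (r i).val

theorem residueSum_comp_perm (r : Fin 3 → ZMod p) (σ : Equiv.Perm (Fin 3)) :
    residueSum (r ∘ σ) = residueSum r :=
  Equiv.sum_comp σ fun i ↦ (r i).val

theorem residueSum_eq [NeZero p] (hr : ∀ i, r i ≠ 0) (hsum : ∑ i, r i = 0) :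
    residueSum r = p ∨ residueSum r = 2 * p := by
  obtain ⟨c, hc⟩ : p ∣ residueSum r := by
    rw [← ZMod.natCast_eq_zero_iff, residueSum, Nat.cast_sum, ← hsum]
    exact Finset.sum_congr rfl fun i _ ↦ ZMod.natCast_zmod_val (r i)
  have hpos : 0 < p * c := by
    rw [← hc]
    exact Finset.sum_pos (fun i _ ↦ Nat.pos_of_ne_zero ((ZMod.val_ne_zero _).2 (hr i)))
      Finset.univ_nonempty
  have hlt : p * c < p * 3 := by
    have hval (i) := ZMod.val_lt (r i)
    rw [← hc, residueSum, Fin.sum_univ_three]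
    linarith [hval 0, hval 1, hval 2]
  have hc₀ : 0 < c := Nat.pos_of_mul_pos_left hpos
  have hc₃ : c < 3 := Nat.lt_of_mul_lt_mul_left hlt
  interval_cases c <;> lia

theorem residueSum_neg [NeZero p] (hr : ∀ i, r i ≠ 0) : residueSum (-r) + residueSum r = 3 * p := by
  have hval (i) : (-r i).val + (r i).val = p := by
    have : NeZero (r i) := ⟨hr i⟩
    rw [ZMod.val_neg_of_ne_zero, Nat.sub_add_cancel (ZMod.val_lt _).le]
  simp only [residueSum, Pi.neg_apply, ← Finset.sum_add_distrib, hval]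
  simp

theorem exists_smul_residueSum_eq [Fact p.Prime] (hr : ∀ i, r i ≠ 0) (hsum : ∑ i, r i = 0) :
    ∃ (i : Fin 3) (κ κ' : ZMod p), κ ≠ 0 ∧ κ' * r i = κ * r (i + 1) ∧
      residueSum (κ • r) = 2 * p ∧ residueSum (κ' • r) = 2 * p := by
  have hdich (i) : residueSum (r i • r) = p ∨ residueSum (r i • r) = 2 * p :=
    residueSum_eq (fun j ↦ mul_ne_zero (hr i) (hr j))
      (by simp only [Pi.smul_apply, smul_eq_mul, ← Finset.mul_sum, hsum, mul_zero])
  -- Of three numbers taking two values, two cyclically adjacent ones agree.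
  obtain ⟨i, hi⟩ : ∃ i : Fin 3, residueSum (r i • r) = residueSum (r (i + 1) • r) := by
    by_contra! hne
    have h₀ := hne 0
    have h₁ := hne 1
    have h₂ := hne 2
    have := hdich 0
    have := hdich 1
    have := hdich 2
    simp only [zero_add, Fin.reduceAdd] at h₀ h₁ h₂
    lia
  rcases hdich i with hp | h2p
  · have hneg (j) := residueSum_neg (r := r j • r) fun k ↦ mul_ne_zero (hr j) (hr k)
    refine ⟨i, -r i, -r (i + 1), neg_ne_zero.2 (hr i), by ring, ?_, ?_⟩
    · have := hneg i
      rw [neg_smul]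
      lia
    · have := hneg (i + 1)
      rw [neg_smul]
      lia
  · exact ⟨i, r i, r (i + 1), hr i, mul_comm _ _, h2p, hi ▸ h2p⟩

/-- The integers of absolute value less than `p` that lift the entries of `r`, the first one being
nonnegative and the others negative. Their sum is zero if `residueSum r = 2 * p`. -/
def signedLift (r : Fin 3 → ZMod p) : Fin 3 → ℤ :=
  ![(r 0).val, (r 1).val - p, (r 2).val - p]

theorem sum_signedLift (hr : residueSum r = 2 * p) : ∑ i, signedLift r i = 0 := by
  rw [residueSum, Fin.sum_univ_three] at hr
  simp only [signedLift, Fin.sum_univ_three, Matrix.cons_val]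
  lia

theorem intCast_signedLift [NeZero p] (r : Fin 3 → ZMod p) (i : Fin 3) :
    (signedLift r i : ZMod p) = r i := by
  fin_cases i <;> simp [signedLift]

theorem abs_signedLift_le [NeZero p] (r : Fin 3 → ZMod p) (i : Fin 3) : |signedLift r i| ≤ p := by
  rw [abs_le]
  have := ZMod.val_lt (r i)
  fin_cases i <;> simp [signedLift, -ZMod.natCast_val] at * <;> lia

theorem signedLift_zero_lt [NeZero p] (r : Fin 3 → ZMod p) : signedLift r 0 < p :=
  Nat.cast_lt.2 (ZMod.val_lt (r 0))

theorem signedLift_zero_pos (hr : r 0 ≠ 0) : 0 < signedLift r 0 :=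
  Nat.cast_pos.2 (Nat.pos_of_ne_zero ((ZMod.val_ne_zero _).2 hr))

theorem signedLift_neg [NeZero p] (r : Fin 3 → ZMod p) {i : Fin 3} (hi : i ≠ 0) :
    signedLift r i < 0 := by
  have := ZMod.val_lt (r i)
  fin_cases i
  · exact absurd rfl hi
  all_goals exact sub_neg_of_lt (Nat.cast_lt.2 this)

theorem neg_lt_signedLift_one (hr : r 1 ≠ 0) : -p < signedLift r 1 := by
  have := Nat.pos_of_ne_zero ((ZMod.val_ne_zero _).2 hr)
  simp only [signedLift, Matrix.cons_val]
  lia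

theorem val_sub_injective (p : ℕ) [NeZero p] :
    Function.Injective fun a : ZMod p ↦ (a.val : ℤ) - p := fun _ _ hab ↦
  ZMod.val_injective p (Int.ofNat_inj.1 (sub_left_injective hab))

end ResidueSums

theorem injective_smul_of_sum_eq_zero {F : Type*} [Field F] {r : Fin 3 → F} {κ κ' : F}
    (hr₀ : ∀ i, r i ≠ 0) (hr : Function.Injective r) (hsum : ∑ i, r i = 0)
    (hω : ¬∃ ω, ∀ i, ω * r i = r (i + 1)) (hκ : κ ≠ 0) (hκ' : κ' * r 0 = κ * r 1) :
    Function.Injective ![κ * r 1, κ * r 0, κ * r 2, κ' * r 1, κ' * r 2] := by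
  rw [Fin.sum_univ_three] at hsum
  have h₀₁ : r 0 ≠ r 1 := hr.ne (by decide)
  have h₀₂ : r 0 ≠ r 2 := hr.ne (by decide)
  have h₁₂ : r 1 ≠ r 2 := hr.ne (by decide)
  have hκκ' : κ ≠ κ' := by grind
  have hκ'₀ : κ' ≠ 0 := by grind
  have h₂₁' : κ * r 2 ≠ κ' * r 1 := fun h ↦ by
    refine hω ⟨κ' / κ, fun i ↦ ?_⟩
    rw [div_mul_eq_mul_div, div_eq_iff hκ, mul_comm _ κ]
    fin_cases i
    exacts [hκ', h.symm, show κ' * r 2 = κ * r 0 by linear_combination (κ' - κ) * hsum - hκ' + h]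
  have h₀₂' : κ * r 0 ≠ κ' * r 2 := fun h ↦
    h₂₁' (by linear_combination (κ - κ') * hsum + hκ' - h)
  have h₀₁' : κ * r 0 ≠ κ' * r 1 := fun h ↦ mul_left_injective₀ (hr₀ 2) |>.ne hκκ'
    (by linear_combination (κ - κ') * hsum + hκ' - h)
  have h₁₂' : κ * r 1 ≠ κ' * r 2 := fun h ↦ h₀₂ (mul_left_cancel₀ hκ'₀ (hκ'.trans h))
  rw [← List.nodup_ofFn]
  simp [hr₀, hκ, hκ'₀, hκκ', h₀₁.symm, h₀₂, h₁₂, h₀₁', h₀₂', h₁₂', h₂₁']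

section DistinctExponents

variable {l p : ℕ} {τ : ℝ} {φ : Fin 3 → EnnolaField l →ₐ[ℚ] ℝ} {u : (𝓞 (EnnolaField l))ˣ}
  {n : Fin 3 → ℤ}

theorem coeffExponents_swap_zero_one_ne {m : Fin 3 → ℤ} (hm : ∑ i, m i = 0) (hm₁ : m 1 ≠ 0) :
    coeffExponents (m ∘ (Equiv.swap 0 1).symm) 1 ≠
      coeffExponents (m ∘ (Equiv.swap 1 2).symm) 0 := by
  rw [Fin.sum_univ_three] at hm
  have h₂₀ : Equiv.swap (1 : Fin 3) 2 0 = 0 := rfl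
  simp only [coeffExponents, coeffRoot, coeffSubOne, Function.comp_apply, Equiv.symm_swap,
    Equiv.swap_apply_left, Equiv.swap_apply_right, h₂₀, Matrix.cons_val]
  lia

namespace HasExponents

variable [Fact p.Prime]

theorem exists_hasSize_signedLift (hu : HasExponents p u n) (hφ : LocatesRoots φ) (h : IsScale p τ)
    (hl : τ ^ p = l) (σ : Equiv.Perm (Fin 3)) {m : Fin 3 → ZMod p} {κ : ZMod p}
    (hm : ∀ i, m i = κ * n (σ i)) (hκ : residueSum (κ • fun i ↦ (n i : ZMod p)) = 2 * p) :
    ∃ v : (𝓞 (EnnolaField l))ˣ, (∃ t : ℤ, (t : ℝ) = ∑ i, φ (σ i) v) ∧ ∀ i,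
      HasSize p τ (signedLift m i) (coeffExponents (signedLift m ∘ σ.symm) (σ i)) (φ (σ i) v) := by
  have hres : residueSum m = 2 * p := by
    rw [← hκ, ← residueSum_comp_perm (κ • _) σ]
    exact congrArg residueSum (funext hm)
  obtain ⟨v, -, hv⟩ := hu.exists_hasSize hφ h hl σ (sum_signedLift hres) (abs_signedLift_le m)
    fun i ↦ (intCast_signedLift m i).trans (hm i)
  exact ⟨v, hφ.exists_int_eq_sum_perm h hl σ v, hv⟩

theorem false_of_shift (hu : HasExponents p u n) (hφ : LocatesRoots φ) (h : IsScale p τ)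
    (hl : τ ^ p = l) (hn : ∀ i, (n i : ZMod p) ≠ 0)
    (hinj : Function.Injective fun i ↦ (n i : ZMod p)) {ω : ZMod p}
    (hω : ∀ i, ω * n i = n (i + 1)) : False := by
  obtain ⟨κ, hκ, hres⟩ : ∃ κ : ZMod p, κ ≠ 0 ∧
      residueSum (κ • fun i ↦ (n i : ZMod p)) = 2 * p := by
    rcases residueSum_eq hn hu.sum_intCast_eq_zero with hp | h2p
    · refine ⟨-1, neg_ne_zero.2 one_ne_zero, ?_⟩
      have := residueSum_neg hn
      rw [neg_one_smul]
      lia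
    · exact ⟨1, one_ne_zero, by rwa [one_smul]⟩
  have hres' : residueSum ((κ * ω) • fun i ↦ (n i : ZMod p)) = 2 * p := by
    rw [← hres, ← residueSum_comp_perm (κ • _) (Equiv.addRight 1)]
    exact congrArg residueSum (funext fun i ↦ by simp [mul_assoc, hω])
  set m : Fin 3 → ZMod p := fun i ↦ κ * n (Equiv.swap 0 1 i) with hm
  have hm₀ (i) : m i ≠ 0 := mul_ne_zero hκ (hn _)
  have hm' (i) : m i = κ * ω * n (Equiv.swap 1 2 i) := by
    rw [mul_assoc, hω]
    fin_cases i <;> rfl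
  obtain ⟨v, ⟨t, ht⟩, hv⟩ := hu.exists_hasSize_signedLift hφ h hl _ (fun i ↦ congrFun hm i) hres
  obtain ⟨w, ⟨t', ht'⟩, hw⟩ := hu.exists_hasSize_signedLift hφ h hl _ hm' hres'
  have hminj : Function.Injective ![signedLift m 0 - p, signedLift m 1, signedLift m 2] := by
    convert (val_sub_injective p).comp
      ((mul_right_injective₀ hκ).comp (hinj.comp (Equiv.swap 0 1).injective)) using 1
    funext i
    fin_cases i <;> rfl
  have hneg (i) (hi : i ≠ 0) : signedLift m i < 0 := signedLift_neg m hi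
  have hsum : ∑ i, signedLift m i = 0 := sum_signedLift
    ((residueSum_comp_perm (κ • fun i ↦ (n i : ZMod p)) (Equiv.swap 0 1)).trans hres)
  exact false_of_hasSize_of_coeff_ne h (signedLift_zero_pos (hm₀ 0)) (signedLift_zero_lt m) hneg
    hminj (coeffExponents_swap_zero_one_ne hsum (hneg 1 one_ne_zero).ne) hv hw ht ht'

theorem false_of_not_shift (hu : HasExponents p u n) (hφ : LocatesRoots φ) (h : IsScale p τ)
    (hl : τ ^ p = l) (hn : ∀ i, (n i : ZMod p) ≠ 0)
    (hinj : Function.Injective fun i ↦ (n i : ZMod p))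
    (hω : ¬∃ ω : ZMod p, ∀ i, ω * n i = n (i + 1)) : False := by
  obtain ⟨j, κ, κ', hκ, hκ', hres, hres'⟩ := exists_smul_residueSum_eq hn hu.sum_intCast_eq_zero
  set ρ : Equiv.Perm (Fin 3) := Equiv.addLeft j
  obtain ⟨v, ⟨t, ht⟩, hv⟩ :=
    hu.exists_hasSize_signedLift hφ h hl ((Equiv.swap 0 1).trans ρ) (fun _ ↦ rfl) hres
  obtain ⟨w, ⟨t', ht'⟩, hw⟩ := hu.exists_hasSize_signedLift hφ h hl ρ (fun _ ↦ rfl) hres'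
  set m : Fin 3 → ZMod p := fun i ↦ κ * n (ρ (Equiv.swap 0 1 i))
  set m' : Fin 3 → ZMod p := fun i ↦ κ' * n (ρ i)
  have hm₀ : m' 0 = m 0 := by simpa [m, m', ρ] using hκ'
  have hωρ : ¬∃ ω : ZMod p, ∀ i, ω * n (ρ i) = n (ρ (i + 1)) := fun ⟨ω, h⟩ ↦
    hω ⟨ω, fun i ↦ by simpa [ρ, ← add_assoc] using h (i - j)⟩
  have hmm' : Function.Injective
      ![signedLift m 0 - p, signedLift m 1, signedLift m 2, signedLift m' 1, signedLift m' 2] := by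
    convert (val_sub_injective p).comp (injective_smul_of_sum_eq_zero (fun i ↦ hn (ρ i))
      (hinj.comp ρ.injective) ((Equiv.sum_comp ρ _).trans hu.sum_intCast_eq_zero) hωρ hκ
      (by simpa [ρ] using hκ')) using 1
    funext i
    fin_cases i <;> rfl
  exact false_of_hasSize_of_injective h (signedLift_zero_lt m)
    (neg_lt_signedLift_one (mul_ne_zero hκ (hn _))) (fun i hi ↦ signedLift_neg m hi)
    (fun i hi ↦ signedLift_neg m' hi) (by simp [signedLift, hm₀]) hmm' hv hw ht ht'

end HasExponents

end DistinctExponents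

theorem IsScale.not_dvd_unitIndex {l p : ℕ} {τ : ℝ} (h : IsScale p τ) (hl : τ ^ p = l)
    (hp : p.Prime) : ¬p ∣ unitIndex l := fun hdvd ↦ by
  have : Fact p.Prime := ⟨hp⟩
  have hl₃ : 3 ≤ l := le_trans (by norm_num) (h.six_le hl)
  obtain ⟨φ, hφ⟩ := exists_locatesRoots hl₃
  have := hφ.finiteIndex_ennolaSubgroup hl₃
  obtain ⟨u, n, hu, i, hi⟩ := exists_hasExponents hp hdvd
  have hn (j) : (n j : ZMod p) ≠ 0 := fun hj ↦ hu.false_of_eq_zero hφ h hl hj hi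
  have hinj : Function.Injective fun j ↦ (n j : ZMod p) := fun j k hjk ↦
    not_not.1 fun hne ↦ hu.false_of_eq hφ h hl hne (hn j) hjk
  by_cases hω : ∃ ω : ZMod p, ∀ j, ω * n j = n (j + 1)
  · exact hu.false_of_shift hφ h hl hn hinj hω.choose_spec
  · exact hu.false_of_not_shift hφ h hl hn hinj hω

theorem not_dvd_unitIndex {l p : ℕ} (hp : p.Prime) (hl : (1000 * p) ^ p ≤ l) :
    ¬p ∣ unitIndex l := by
  have hpow : ((l : ℝ) ^ (p : ℝ)⁻¹) ^ p = l :=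
    Real.rpow_inv_natCast_pow (Nat.cast_nonneg l) hp.ne_zero
  have hle : 1000 * (p : ℝ) ≤ (l : ℝ) ^ (p : ℝ)⁻¹ := by
    rw [← pow_le_pow_iff_left₀ (by positivity) (by positivity) hp.ne_zero, hpow]
    exact_mod_cast hl
  exact IsScale.not_dvd_unitIndex ⟨hp.two_le, hle⟩ hpow hp

theorem computable_mul_pow_self (c : ℕ) : Computable fun N : ℕ ↦ (c * N) ^ N :=
  have hpow : Primrec₂ fun a b : ℕ ↦ a ^ b := Primrec₂.unpaired'.1 Nat.Primrec.pow
  (hpow.comp (Primrec.nat_mul.comp (Primrec.const c) Primrec.id) Primrec.id).to_comp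

theorem theorem1_general :
    (∀ p : ℕ, p.Prime → {l : ℕ | p ∣ unitIndex l} ⊆ Set.Iio ((1000 * p) ^ p)) ∧
      ∀ N l : ℕ, (1000 * N) ^ N ≤ l → Nat.gcd (unitIndex l) (Nat.factorial N) = 1 := by
  refine ⟨fun p hp l hdvd ↦ not_le.1 fun hl ↦ not_dvd_unitIndex hp hl hdvd, fun N l hl ↦ ?_⟩
  refine Nat.coprime_of_dvd fun p hp hdvd hpN ↦ not_dvd_unitIndex hp (le_trans ?_ hl) hdvd
  have hle : p ≤ N := hp.dvd_factorial.1 hpN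
  calc (1000 * p) ^ p ≤ (1000 * N) ^ p := by gcongr
    _ ≤ (1000 * N) ^ N := Nat.pow_le_pow_right (by have := hp.pos; lia) hle

theorem theorem1 :
    (∀ p : ℕ, p.Prime → 3 ≤ p → {l : ℕ | 3 ≤ l ∧ p ∣ unitIndex l}.Finite) ∧
    ∃ L : ℕ → ℕ, Computable L ∧
      ∀ N : ℕ, 2 ≤ N → ∀ l : ℕ, 3 ≤ l → L N ≤ l →
        Nat.gcd (unitIndex l) (Nat.factorial N) = 1 :=
  ⟨fun p hp _ ↦ (Set.finite_Iio _).subset fun _ hl ↦ theorem1_general.1 p hp hl.2,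
    _, computable_mul_pow_self 1000, fun N _ l _ ↦ theorem1_general.2 N l⟩
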